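/- Let $\mathbb T=\mathbb R/\mathbb Z$ with Lebesgue measure. A supernatural number is a formal product $\mathfrak N=\prod_p p^{N_p}$ over the primes, with $N_p\in\{0,1,2,\dots\}\cup\{\infty\}$; a positive integer $n$ divides $\mathfrak N$ if for every prime $p$ the exponent of $p$ in $n$ is at most $N_p$. A UHF algebra with supernatural number $\mathfrak N$ is a unital $C^*$-algebra that is the norm closure of an increasing sequence of unital $*$-subalgebras $A_n\cong\mathbb C^{k_n\times k_n}$, $k_n\ge 1$, such that for every prime $p$ the number $N_p$ is the supremum of the exponents of $p$ in the integers $k_n$ (full matrix algebras are included). On $L^2(\mathbb T)=L^2(\mathbb T\to\mathbb C)$ consider the finite derivatives $D_{1,h}u(x)=\frac{u(x+h)-u(x)}{h}$ and the multiplication operators $M_Su(x)=S(x)u(x)$. For $B\subset\mathbb T$ with $0\in B$, a regulated function with breakpoints in $B$ is a uniform limit of finite complex linear combinations of characteristic functions of arcs $[a,b)\subset\mathbb T$ with $a,b\in B$ (the whole circle is counted as an arc). Let $\mathcal H_{1,1}(\mathfrak N)$ be the norm-closed subalgebra of the bounded operators on $L^2(\mathbb T)$ generated by all $D_{1,h}$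 with $h=p^{-j}$, $p$ prime, $j\in\mathbb N$, $1\le j\le N_p$, and by all $M_S$ with $S$ a regulated function with breakpoints in $\{0\}\cup\{p^{-s}: p \text{ prime},\ s\in\mathbb N,\ 1\le s\le N_p\}$. Then every UHF algebra $V$ with supernatural number $\mathfrak N$ is $*$-isomorphic to $\mathcal H_{1,1}(\mathfrak N)$. The same holds if in the definition of $\mathcal H_{1,1}(\mathfrak N)$ all the points $m/n$, with $m\in\mathbb Z$ and $n$ a positive integer dividing $\mathfrak N$, are admitted as breakpoints. In particular, the CAR algebra, i.e. the nonzero unital $C^*$-algebra generated by elements $a_0,a_1,a_2,\dots$ with $a_ia_j+a_ja_i=0$ and $a_ia_j^*+a_j^*a_i=\delta_{ij}1$, is $*$-isomorphic to the norm-closed algebra generated by the dyadic derivatives $D_{1,2^{-j}}$, $j\ge1$, and the operators $M_S$ with $S$ a regulated function with dyadic breakpoints $m/2^{j}$, $m\in\mathbb Z$, $j\ge 0$. -/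

import Mathlib

open MeasureTheory
open scoped ENNReal

noncomputable section

/-! ### Supernatural numbers and UHF algebras -/

/-- A supernatural number `∏ p ^ N_p`, given by its exponents `N_p ∈ {0, 1, 2, …, ∞}`. -/
abbrev SupernaturalNumber : Type := Nat.Primes → ℕ∞

/-- The natural number `n` divides the supernatural number `𝔑`. -/
def SupernaturalNumber.IsDivisor (n : ℕ) (𝔑 : SupernaturalNumber) : Prop :=
  0 < n ∧ ∀ p : Nat.Primes, (n.factorization p : ℕ∞) ≤ 𝔑 p

/-- `V` is a UHF algebra with supernatural number `𝔑`: it is the norm closure of an increasing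
sequence of unital `*`-subalgebras `A n` that are `*`-isomorphic to full matrix algebras
of sizes `k n ≥ 1`, and `𝔑` is the least common multiple of the sizes. -/
def IsUHF (V : Type*) [CStarAlgebra V] (𝔑 : SupernaturalNumber) : Prop :=
  ∃ (A : ℕ → StarSubalgebra ℂ V) (k : ℕ → ℕ),
    Monotone A ∧
    (∀ n, 0 < k n ∧ Nonempty (A n ≃⋆ₐ[ℂ] Matrix (Fin (k n)) (Fin (k n)) ℂ)) ∧
    Dense (⋃ n, (A n : Set V)) ∧
    ∀ p : Nat.Primes, 𝔑 p = ⨆ n, ((k n).factorization p : ℕ∞)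

/-- `W` is the CAR algebra on the generators `a 0, a 1, …`: these satisfy the canonical
anticommutation relations and generate `W` as a unital C⋆-algebra. -/
structure IsCARAlgebra {W : Type*} [CStarAlgebra W] (a : ℕ → W) : Prop where
  nontrivial : Nontrivial W
  anticomm : ∀ i j, a i * a j + a j * a i = 0
  anticomm_star : ∀ i j, a i * star (a j) + star (a j) * a i = if i = j then 1 else 0
  generates : (StarAlgebra.adjoin ℂ (Set.range a)).topologicalClosure = ⊤

/-! ### Operators on `L²` of the circle `𝕋 = ℝ / ℤ` with Lebesgue measure -/

/-- The Hilbert space `L²(𝕋 → ℂ)`. -/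
abbrev L2Circle : Type := Lp ℂ 2 (volume : Measure UnitAddCircle)

/-- The operator `u ↦ u (· + t)`. -/
def shiftOp (t : UnitAddCircle) : L2Circle →L[ℂ] L2Circle :=
  (Lp.compMeasurePreservingₗᵢ ℂ (fun x : UnitAddCircle => x + t)
    (measurePreserving_add_right volume t)).toContinuousLinearMap

/-- The finite derivative `u ↦ (u (· + h) - u) / h`. -/
def finiteDerivative (h : ℝ) : L2Circle →L[ℂ] L2Circle :=
  ((h : ℂ)⁻¹) • (shiftOp (h : UnitAddCircle) - 1)

/-- The operator of multiplication by an essentially bounded function. -/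
def multOp (f : Lp ℂ ∞ (volume : Measure UnitAddCircle)) : L2Circle →L[ℂ] L2Circle :=
  (ContinuousLinearMap.mul ℂ ℂ).holderL volume ∞ 2 2 f

/-! ### Regulated functions -/

/-- The image in `𝕋` of the interval `[p, q)`. It is empty for `q ≤ p`, an arc
for `p < q < p + 1`, and all of `𝕋` for `p + 1 ≤ q`. -/
def arc (p q : ℝ) : Set UnitAddCircle :=
  (fun t : ℝ => (t : UnitAddCircle)) '' Set.Ico p q

/-- Finite linear combinations of indicators of arcs whose end points, as points of `𝕋`,
belong to `B`. -/
def stepFunctions (B : Set UnitAddCircle) : Submodule ℂ (UnitAddCircle → ℂ) :=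
  Submodule.span ℂ {f | ∃ p q : ℝ, (p : UnitAddCircle) ∈ B ∧ (q : UnitAddCircle) ∈ B ∧
    f = (arc p q).indicator 1}

/-- Regulated functions with breakpoints in `B`: uniform limits of step functions. -/
def IsRegulated (B : Set UnitAddCircle) (S : UnitAddCircle → ℂ) : Prop :=
  ∀ ε > 0, ∃ s ∈ stepFunctions B, ∀ x, ‖S x - s x‖ ≤ ε

theorem measurableSet_arc (p q : ℝ) : MeasurableSet (arc p q) := by
  rcases le_or_gt (p + 1) q with h | h
  · have : arc p q = Set.univ := by
      refine Set.eq_univ_of_univ_subset ?_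
      rw [← AddCircle.coe_image_Ico_eq (p := (1 : ℝ)) p]
      exact Set.image_mono (Set.Ico_subset_Ico_right h)
    rw [this]
    exact MeasurableSet.univ
  · have : arc p q = (AddCircle.measurableEquivIco (1 : ℝ) p) ⁻¹'
        (Subtype.val ⁻¹' Set.Ico p q) := by
      ext x
      constructor
      · rintro ⟨t, ht, rfl⟩
        have ht' : t ∈ Set.Ico p (p + 1) := ⟨ht.1, ht.2.trans h⟩
        have : AddCircle.measurableEquivIco (1 : ℝ) p (t : UnitAddCircle) = ⟨t, ht'⟩ :=
          Subtype.ext (AddCircle.equivIco_coe_of_mem ht')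
        simp only [Set.mem_preimage, this]
        exact ht
      · intro hx
        exact ⟨_, hx, (AddCircle.equivIco (1 : ℝ) p).symm_apply_apply x⟩
    rw [this]
    exact (AddCircle.measurableEquivIco (1 : ℝ) p).measurable
      (measurable_subtype_coe measurableSet_Ico)

theorem stepFunctions_spec {B : Set UnitAddCircle} {s : UnitAddCircle → ℂ}
    (hs : s ∈ stepFunctions B) :
    Measurable s ∧ (∃ C : ℝ, ∀ x, ‖s x‖ ≤ C) ∧ (fun x => star (s x)) ∈ stepFunctions B := by
  induction hs using Submodule.span_induction with
  | mem f hf =>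
    obtain ⟨p, q, hp, hq, rfl⟩ := hf
    refine ⟨measurable_one.indicator (measurableSet_arc p q), ⟨1, fun x => ?_⟩, ?_⟩
    · by_cases hx : x ∈ arc p q <;> simp [hx]
    · have : (fun x => star ((arc p q).indicator (1 : UnitAddCircle → ℂ) x)) =
          (arc p q).indicator 1 := by
        ext x
        by_cases hx : x ∈ arc p q <;> simp [hx]
      rw [this]
      exact Submodule.subset_span ⟨p, q, hp, hq, rfl⟩
  | zero =>
    refine ⟨measurable_zero, ⟨0, by simp⟩, ?_⟩
    have : (fun x => star ((0 : UnitAddCircle → ℂ) x)) = 0 := by ext; simp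
    rw [this]
    exact zero_mem _
  | add f g _ _ hf hg =>
    obtain ⟨hf, ⟨C, hC⟩, hf'⟩ := hf
    obtain ⟨hg, ⟨D, hD⟩, hg'⟩ := hg
    refine ⟨hf.add hg, ⟨C + D, fun x => (norm_add_le _ _).trans (add_le_add (hC x) (hD x))⟩, ?_⟩
    have : (fun x => star ((f + g) x)) = (fun x => star (f x)) + fun x => star (g x) := by
      ext; simp
    rw [this]
    exact add_mem hf' hg'
  | smul c f _ hf =>
    obtain ⟨hf, ⟨C, hC⟩, hf'⟩ := hf
    refine ⟨hf.const_smul c, ⟨‖c‖ * C, fun x => ?_⟩, ?_⟩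
    · rw [Pi.smul_apply, norm_smul]
      exact mul_le_mul_of_nonneg_left (hC x) (norm_nonneg c)
    · have : (fun x => star ((c • f) x)) = (star c) • fun x => star (f x) := by
        ext; simp
      rw [this]
      exact Submodule.smul_mem _ _ hf'

theorem IsRegulated.star {B : Set UnitAddCircle} {S : UnitAddCircle → ℂ}
    (hS : IsRegulated B S) : IsRegulated B (fun x => Star.star (S x)) := by
  intro ε hε
  obtain ⟨s, hs, h⟩ := hS ε hε
  refine ⟨_, (stepFunctions_spec hs).2.2, fun x => ?_⟩
  rw [← star_sub, norm_star]
  exact h x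

theorem IsRegulated.memLp {B : Set UnitAddCircle} {S : UnitAddCircle → ℂ}
    (hS : IsRegulated B S) : MemLp S ∞ (volume : Measure UnitAddCircle) := by
  have hm : Measurable S := by
    choose s hs h using fun n : ℕ => hS (1 / ((n : ℝ) + 1)) (by positivity)
    refine measurable_of_tendsto_metrizable (fun n => (stepFunctions_spec (hs n)).1)
      (tendsto_pi_nhds.2 fun x => ?_)
    rw [tendsto_iff_norm_sub_tendsto_zero]
    refine squeeze_zero (fun _ => norm_nonneg _) (fun n => ?_)
      tendsto_one_div_add_atTop_nhds_zero_nat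
    rw [norm_sub_rev]
    exact h n x
  obtain ⟨s, hs, h⟩ := hS 1 one_pos
  obtain ⟨C, hC⟩ := (stepFunctions_spec hs).2.1
  refine memLp_top_of_bound hm.aestronglyMeasurable (1 + C) (Filter.Eventually.of_forall fun x => ?_)
  calc ‖S x‖ = ‖(S x - s x) + s x‖ := by rw [sub_add_cancel]
    _ ≤ 1 + C := (norm_add_le _ _).trans (add_le_add (h x) (hC x))

/-! ### The algebra of finite differential operators -/

/-- The finite derivatives with steps `1 / q`, `q ∈ Q`, and the operators of multiplication by
regulated functions with breakpoints in `B`. -/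
def fdGenerators (Q : Set ℕ) (B : Set UnitAddCircle) : Set (L2Circle →L[ℂ] L2Circle) :=
  {T | ∃ q ∈ Q, T = finiteDerivative (1 / (q : ℝ))} ∪
    {T | ∃ (S : UnitAddCircle → ℂ) (hS : IsRegulated B S), T = multOp (hS.memLp.toLp S)}

theorem shiftOp_coeFn (t : UnitAddCircle) (u : L2Circle) :
    shiftOp t u =ᵐ[volume] fun x => u (x + t) :=
  Lp.coeFn_compMeasurePreserving u (measurePreserving_add_right volume t)

theorem multOp_coeFn {S : UnitAddCircle → ℂ} (hS : MemLp S ∞ volume) (u : L2Circle) :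
    multOp (hS.toLp S) u =ᵐ[volume] fun x => S x * u x := by
  refine ((ContinuousLinearMap.mul ℂ ℂ).coeFn_holder (r := 2) (hS.toLp S) u).trans ?_
  filter_upwards [hS.coeFn_toLp] with x hx
  simp [hx]

theorem shiftOp_add (s t : UnitAddCircle) : shiftOp (s + t) = shiftOp s * shiftOp t := by
  ext u
  have h1 := (measurePreserving_add_right volume s).quasiMeasurePreserving.ae (shiftOp_coeFn t u)
  filter_upwards [shiftOp_coeFn (s + t) u, shiftOp_coeFn s (shiftOp t u), h1] with x h h2 h1
  rw [mul_apply_eq_comp, h, h2, h1, add_assoc]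

theorem shiftOp_zero : shiftOp 0 = 1 := by
  ext u
  filter_upwards [shiftOp_coeFn 0 u] with x h
  rw [h, add_zero, one_apply_eq_self]

theorem shiftOp_nsmul (n : ℕ) (t : UnitAddCircle) : shiftOp (n • t) = shiftOp t ^ n := by
  induction n with
  | zero => rw [zero_smul, shiftOp_zero, pow_zero]
  | succ n ih => rw [succ_nsmul, shiftOp_add, ih, pow_succ]

theorem star_shiftOp (t : UnitAddCircle) : star (shiftOp t) = shiftOp (-t) := by
  rw [ContinuousLinearMap.star_eq_adjoint, eq_comm, ContinuousLinearMap.eq_adjoint_iff]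
  intro u v
  have hv : v = shiftOp (-t) (shiftOp t v) := by
    rw [← mul_apply_eq_comp, ← shiftOp_add, neg_add_cancel, shiftOp_zero,
      one_apply_eq_self]
  conv_lhs => rw [hv]
  exact LinearIsometry.inner_map_map (Lp.compMeasurePreservingₗᵢ ℂ
    (fun x : UnitAddCircle => x + -t) (measurePreserving_add_right volume (-t))) u (shiftOp t v)

theorem star_multOp {S : UnitAddCircle → ℂ} (hS : MemLp S ∞ volume)
    (hS' : MemLp (fun x => star (S x)) ∞ volume) :
    star (multOp (hS.toLp S)) = multOp (hS'.toLp _) := by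
  rw [ContinuousLinearMap.star_eq_adjoint, eq_comm, ContinuousLinearMap.eq_adjoint_iff]
  intro u v
  rw [L2.inner_def, L2.inner_def]
  refine integral_congr_ae ?_
  filter_upwards [multOp_coeFn hS v, multOp_coeFn hS' u] with x h h'
  rw [h, h']
  simp only [RCLike.inner_apply, map_mul, RCLike.star_def, RCLike.conj_conj]
  ring

theorem star_mem_adjoin_fdGenerators {Q : Set ℕ} {B : Set UnitAddCircle}
    {T : L2Circle →L[ℂ] L2Circle} (hT : T ∈ Algebra.adjoin ℂ (fdGenerators Q B)) :
    star T ∈ Algebra.adjoin ℂ (fdGenerators Q B) := by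
  induction hT using Algebra.adjoin_induction with
  | mem T hT =>
    rcases hT with ⟨q, hq, rfl⟩ | ⟨S, hS, rfl⟩
    · have hD : finiteDerivative (1 / (q : ℝ)) ∈ Algebra.adjoin ℂ (fdGenerators Q B) :=
        Algebra.subset_adjoin (Or.inl ⟨q, hq, rfl⟩)
      rcases Nat.eq_zero_or_pos q with rfl | hq0
      · simp [finiteDerivative]
      have hq1 : ((1 / (q : ℝ) : ℝ) : ℂ) ≠ 0 := by
        have : (q : ℂ) ≠ 0 := by exact_mod_cast hq0.ne'
        simpa using this
      have hU : shiftOp ((1 / (q : ℝ) : ℝ) : UnitAddCircle) ∈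
          Algebra.adjoin ℂ (fdGenerators Q B) := by
        have : shiftOp ((1 / (q : ℝ) : ℝ) : UnitAddCircle) =
            ((1 / (q : ℝ) : ℝ) : ℂ) • finiteDerivative (1 / (q : ℝ)) + 1 := by
          rw [finiteDerivative, smul_smul, mul_inv_cancel₀ hq1, one_smul, sub_add_cancel]
        rw [this]
        exact add_mem (Subalgebra.smul_mem _ hD _) (one_mem _)
      have hneg : -((1 / (q : ℝ) : ℝ) : UnitAddCircle) =
          (q - 1) • ((1 / (q : ℝ) : ℝ) : UnitAddCircle) := by
        rw [neg_eq_iff_add_eq_zero, ← succ_nsmul', Nat.sub_add_cancel hq0, ← AddCircle.coe_nsmul,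
          nsmul_eq_mul, mul_one_div_cancel (by exact_mod_cast hq0.ne')]
        exact AddCircle.coe_period 1
      rw [finiteDerivative, star_smul, star_sub, star_one, star_shiftOp, hneg, shiftOp_nsmul]
      exact Subalgebra.smul_mem _ (sub_mem (pow_mem hU _) (one_mem _)) _
    · rw [star_multOp hS.memLp hS.star.memLp]
      exact Algebra.subset_adjoin (Or.inr ⟨_, hS.star, rfl⟩)
  | algebraMap r =>
    rw [← algebraMap_star_comm]
    exact Subalgebra.algebraMap_mem _ _
  | add x y _ _ hx hy =>
    rw [star_add]
    exact add_mem hx hy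
  | mul x y _ _ hx hy =>
    rw [star_mul]
    exact mul_mem hy hx

/-- The norm-closed algebra of operators on `L²(𝕋)` generated by the finite derivatives with
steps `1 / q`, `q ∈ Q`, and by multiplications by regulated functions with breakpoints in `B`.
It is closed under adjoints, hence a C⋆-subalgebra. -/
def fdAlgebra (Q : Set ℕ) (B : Set UnitAddCircle) : StarSubalgebra ℂ (L2Circle →L[ℂ] L2Circle) where
  toSubalgebra := (Algebra.adjoin ℂ (fdGenerators Q B)).topologicalClosure
  star_mem' hT := map_mem_closure continuous_star hT fun _ h => star_mem_adjoin_fdGenerators h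

/-- The prime powers `p ^ j` with `1 ≤ j ≤ N_p`. -/
def primePowers (𝔑 : SupernaturalNumber) : Set ℕ :=
  {q | ∃ (p : Nat.Primes) (j : ℕ), 1 ≤ j ∧ (j : ℕ∞) ≤ 𝔑 p ∧ q = (p : ℕ) ^ j}

/-- The points `0` and `p ^ (-j)`, `1 ≤ j ≤ N_p`, of `𝕋`. -/
def primePowerPoints (𝔑 : SupernaturalNumber) : Set UnitAddCircle :=
  {x | x = 0 ∨ ∃ q ∈ primePowers 𝔑, x = ((1 / (q : ℝ) : ℝ) : UnitAddCircle)}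

/-- The points `m / n` of `𝕋` with `n` dividing `𝔑`. -/
def rationalPoints (𝔑 : SupernaturalNumber) : Set UnitAddCircle :=
  {x | ∃ (m : ℤ) (n : ℕ), SupernaturalNumber.IsDivisor n 𝔑 ∧
    x = ((m / n : ℝ) : UnitAddCircle)}

/-- The algebra `ℋ_{1,1}(𝔑)` of one-dimensional scalar finite differential operators. -/
abbrev scalarFDAlgebra (𝔑 : SupernaturalNumber) : StarSubalgebra ℂ (L2Circle →L[ℂ] L2Circle) :=
  fdAlgebra (primePowers 𝔑) (primePowerPoints 𝔑)

/-- The algebra generated by the dyadic derivatives, with steps `2 ^ (-j)`, `j ≥ 1`, and by the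
regulated functions with dyadic breakpoints `m / 2 ^ j`. -/
abbrev dyadicFDAlgebra : StarSubalgebra ℂ (L2Circle →L[ℂ] L2Circle) :=
  fdAlgebra {q | ∃ j : ℕ, 1 ≤ j ∧ q = 2 ^ j}
    {x | ∃ (m : ℤ) (j : ℕ), x = ((m / 2 ^ j : ℝ) : UnitAddCircle)}

end

/-!
Both sides are limits of increasing sequences of full matrix algebras, and such limits are
classified by their supernatural number (Glimm).

*Uniqueness.* Matrix units acting on a finite-dimensional Hilbert space act as a multiple of the
standard representation (`IsMatrixUnits.exists_orthonormalBasis`). Hence a unital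
`*`-homomorphism from `k × k` to `l × l` matrices exists exactly when `k ∣ l`, and two of them
differ by an automorphism of the target (`exists_starAlgEquiv_matrix`). Given two towers `A`, `B`
with the same supernatural number, the size of each `A n` divides the size of some `B m`, and
conversely (`IsUHFTower.exists_dvd`). Correcting embeddings by automorphisms, one extends partial
isomorphisms between the unions back and forth (`PartialIso.exists_extends`). Since a matrix
algebra carries only one C⋆-norm, these are isometric, so the closure of the union of their graphs
is the graph of an isomorphism of the closed unions (`IsUHFTower.nonempty_starAlgEquiv`).

*The algebra of finite differential operators.* For each `n`, the translations by multiples of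
`1 / n` and the indicator functions of the cells `[i / n, (i + 1) / n)` give `n × n` matrix units
on `L²(𝕋)` (`isMatrixUnits_gridUnit`), which span `gridAlgebra`. If `n` divides `𝔑` this algebra
consists of finite differential operators: Bézout's identity produces the shift by `1 / n` from
the shifts by inverse prime powers, and one cell is cut out of an arc `[0, 1 / p)` by means of a
shifted copy of this arc (`gridAlgebra_le_fdAlgebra`). Conversely every generator is a norm limit
of elements of grid algebras. So the algebra is the closed union of a tower with supernatural
number `𝔑`, whatever breakpoints are admitted between the two extreme choices
(`coe_fdAlgebra_eq_closure`).

*The CAR algebra.* By the Jordan–Wigner transform, multiplying `a n` by the parity of the previous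
modes gives an element that commutes with these modes and generates a further tensor factor of
`2 × 2` matrices. So the CAR algebra has a tower of sizes `2 ^ n` (`IsCARAlgebra.isUHFTower`), and
the dyadic algebra is the one attached to the supernatural number `2 ^ ∞`.
-/

/-! ### Systems of matrix units -/

/-- A system of matrix units in a `*`-ring: elements `e i j` multiplying and transposing like the
standard matrix units `E_{ij}`, with `∑ i, e i i = 1`. -/
structure IsMatrixUnits {ι R : Type*} [Fintype ι] [Semiring R] [StarRing R]
    (e : ι → ι → R) : Prop where
  mul_same : ∀ i j k, e i j * e j k = e i k
  mul_ne : ∀ i j k l, j ≠ k → e i j * e k l = 0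
  star_eq : ∀ i j, star (e i j) = e j i
  sum_eq : ∑ i, e i i = 1

section MatrixUnits

variable {ι R : Type*} [Fintype ι] [Ring R] [StarRing R]

theorem IsMatrixUnits.map {S : Type*} [Ring S] [StarRing S] [Algebra ℂ R] [Algebra ℂ S]
    {e : ι → ι → R} (he : IsMatrixUnits e) (φ : R →⋆ₐ[ℂ] S) :
    IsMatrixUnits (fun i j => φ (e i j)) where
  mul_same i j k := by rw [← map_mul, he.mul_same]
  mul_ne i j k l h := by rw [← map_mul, he.mul_ne _ _ _ _ h, map_zero]
  star_eq i j := by rw [← map_star, he.star_eq]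
  sum_eq := by rw [← map_sum, he.sum_eq, map_one]

/-- The product of two systems of matrix units that commute with each other. -/
theorem IsMatrixUnits.prod {κ : Type*} [Fintype κ] {e : ι → ι → R} {f : κ → κ → R}
    (he : IsMatrixUnits e) (hf : IsMatrixUnits f) (hc : ∀ i j s t, Commute (e i j) (f s t)) :
    IsMatrixUnits (fun a b : ι × κ => e a.1 b.1 * f a.2 b.2) where
  mul_same a b c := by
    rw [mul_assoc, ← mul_assoc (f _ _), ← (hc _ _ _ _).eq, mul_assoc, ← mul_assoc (e _ _),
      he.mul_same, hf.mul_same]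
  mul_ne a b c d h := by
    rw [mul_assoc, ← mul_assoc (f _ _), ← (hc _ _ _ _).eq, mul_assoc, ← mul_assoc (e _ _)]
    by_cases h1 : b.1 = c.1
    · have h2 : b.2 ≠ c.2 := fun h2 => h (Prod.ext h1 h2)
      rw [hf.mul_ne _ _ _ _ h2, mul_zero]
    · rw [he.mul_ne _ _ _ _ h1, zero_mul]
  star_eq a b := by rw [star_mul, he.star_eq, hf.star_eq, (hc _ _ _ _).eq]
  sum_eq := by
    rw [Fintype.sum_prod_type]
    simp only [← Finset.mul_sum, hf.sum_eq, mul_one, he.sum_eq]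

theorem IsMatrixUnits.reindex {κ : Type*} [Fintype κ] {e : ι → ι → R} (he : IsMatrixUnits e)
    (σ : κ ≃ ι) : IsMatrixUnits (fun a b : κ => e (σ a) (σ b)) where
  mul_same a b c := he.mul_same _ _ _
  mul_ne a b c d h := he.mul_ne _ _ _ _ fun h' => h (σ.injective h')
  star_eq a b := he.star_eq _ _
  sum_eq := by rw [σ.sum_comp fun i => e i i, he.sum_eq]

variable [DecidableEq ι] [Algebra ℂ R]

theorem StarAlgHom.ext_matrix {φ ψ : Matrix ι ι ℂ →⋆ₐ[ℂ] R}
    (h : ∀ i j, φ (Matrix.single i j 1) = ψ (Matrix.single i j 1)) : φ = ψ := by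
  ext M
  rw [Matrix.matrix_eq_sum_single M]
  simp only [map_sum]
  refine Finset.sum_congr rfl fun i _ => Finset.sum_congr rfl fun j _ => ?_
  have : Matrix.single i j (M i j) = M i j • (Matrix.single i j 1 : Matrix ι ι ℂ) := by simp
  rw [this, map_smul, map_smul, h]

theorem StarAlgHom.injective_of_matrix [Nonempty ι] [Nontrivial R] (φ : Matrix ι ι ℂ →⋆ₐ[ℂ] R) :
    Function.Injective φ :=
  RingHom.injective (φ : Matrix ι ι ℂ →+* R)

variable [StarModule ℂ R]

/-- The unital `*`-homomorphism out of the matrix algebra that sends `E_{ij}` to `e i j`. -/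
noncomputable def IsMatrixUnits.lift {e : ι → ι → R} (he : IsMatrixUnits e) :
    Matrix ι ι ℂ →⋆ₐ[ℂ] R where
  toFun M := ∑ i, ∑ j, M i j • e i j
  map_one' := by
    simp [Matrix.one_apply, ite_smul, he.sum_eq]
  map_zero' := by simp
  map_add' M N := by simp [add_smul, Finset.sum_add_distrib]
  map_mul' M N := by
    have key : ∀ i j, (M i j • e i j) * (∑ k, ∑ l, N k l • e k l) =
        ∑ l, (M i j * N j l) • e i l := by
      intro i j
      rw [Finset.mul_sum, Finset.sum_eq_single j]
      · rw [Finset.mul_sum]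
        exact Finset.sum_congr rfl fun l _ => by
          rw [smul_mul_smul_comm, he.mul_same]
      · intro k _ hk
        rw [Finset.mul_sum]
        exact Finset.sum_eq_zero fun l _ => by
          rw [smul_mul_smul_comm, he.mul_ne _ _ _ _ hk.symm, smul_zero]
      · simp
    simp only [Finset.sum_mul, key, Matrix.mul_apply, Finset.sum_smul]
    exact Finset.sum_congr rfl fun i _ => Finset.sum_comm
  commutes' r := by
    simp [Matrix.algebraMap_matrix_apply, ite_smul, ← Finset.smul_sum, he.sum_eq,
      Algebra.algebraMap_eq_smul_one]
  map_star' M := by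
    simp only [Matrix.star_apply, star_sum, star_smul, he.star_eq]
    exact Finset.sum_comm

theorem IsMatrixUnits.lift_single {e : ι → ι → R} (he : IsMatrixUnits e) (i j : ι) :
    he.lift (Matrix.single i j 1) = e i j := by
  change ∑ k, ∑ l, Matrix.single i j (1 : ℂ) k l • e k l = e i j
  rw [Finset.sum_eq_single i, Finset.sum_eq_single j]
  · simp
  · intro l _ hl
    simp [hl.symm]
  · simp
  · intro k _ hk
    simp [hk.symm]
  · simp

theorem IsMatrixUnits.range_lift_le {e : ι → ι → R} (he : IsMatrixUnits e)
    {T : StarSubalgebra ℂ R} (h : ∀ i j, e i j ∈ T) : he.lift.range ≤ T := by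
  rintro _ ⟨M, rfl⟩
  exact sum_mem fun i _ => sum_mem fun j _ => T.toSubalgebra.smul_mem (h i j) _

theorem isMatrixUnits_single :
    IsMatrixUnits (fun i j => Matrix.single i j 1 : ι → ι → Matrix ι ι ℂ) where
  mul_same i j k := by simp
  mul_ne i j k l h := by simp [h]
  star_eq i j := by simp [Matrix.star_eq_conjTranspose]
  sum_eq := Matrix.sum_single_one

end MatrixUnits

/-! ### Representations of matrix algebras -/

section Representations

variable {ι : Type*} [Fintype ι] [DecidableEq ι] [Nonempty ι]
  {H : Type*} [NormedAddCommGroup H] [InnerProductSpace ℂ H] [CompleteSpace H]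
  [FiniteDimensional ℂ H]

/-- Matrix units acting on a finite-dimensional Hilbert space act on a suitable orthonormal basis
as they do on a multiple of the standard representation. The basis consists of the vectors
`e i i₀ v`, where `v` runs through an orthonormal basis of the range of `e i₀ i₀`. -/
theorem IsMatrixUnits.exists_orthonormalBasis {e : ι → ι → H →L[ℂ] H} (he : IsMatrixUnits e) :
    ∃ (r : ℕ) (b : OrthonormalBasis (ι × Fin r) ℂ H),
      ∀ i j s, e i j (b (j, s)) = b (i, s) := by
  obtain ⟨i₀⟩ := ‹Nonempty ι›
  let K : Submodule ℂ H := LinearMap.range (e i₀ i₀ : H →ₗ[ℂ] H)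
  let v := stdOrthonormalBasis ℂ K
  have hv : ∀ s, e i₀ i₀ (v s) = v s := by
    intro s
    obtain ⟨w, hw⟩ := (v s).2
    change e i₀ i₀ w = v s at hw
    rw [← hw, ← mul_apply_eq_comp, he.mul_same]
  let f : ι × Fin (Module.finrank ℂ K) → H := fun a => e a.1 i₀ (v a.2)
  have hinner : ∀ i j (x y : H), inner ℂ (e i j x) y = inner ℂ x (e j i y) := by
    intro i j x y
    rw [← he.star_eq i j, ContinuousLinearMap.star_eq_adjoint,
      ContinuousLinearMap.adjoint_inner_right]
  have hf : Orthonormal ℂ f := by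
    rw [orthonormal_iff_ite]
    rintro ⟨i, s⟩ ⟨j, t⟩
    change inner ℂ (e i i₀ (v s)) (e j i₀ (v t)) = _
    rw [hinner, ← mul_apply_eq_comp]
    by_cases hij : i = j
    · subst hij
      rw [he.mul_same, hv, ← Submodule.coe_inner, orthonormal_iff_ite.1 v.orthonormal]
      simp
    · rw [he.mul_ne _ _ _ _ hij]
      simp [hij]
  -- Spanning: `x = ∑ i, e i i₀ (e i₀ i x)`, and each `e i₀ i x` lies in the range `K`.
  have hspan : ⊤ ≤ Submodule.span ℂ (Set.range f) := by
    intro x _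
    have hx : x = ∑ i, e i i₀ (e i₀ i x) := by
      conv_lhs => rw [← one_apply_eq_self (F := H →L[ℂ] H) x, ← he.sum_eq]
      rw [sum_apply]
      exact Finset.sum_congr rfl fun i _ => by
        rw [← mul_apply_eq_comp, he.mul_same]
    rw [hx]
    refine sum_mem fun i _ => ?_
    have hK : e i₀ i x ∈ K := ⟨e i₀ i x, by
      change e i₀ i₀ (e i₀ i x) = _
      rw [← mul_apply_eq_comp, he.mul_same]⟩
    have hsum := congrArg Subtype.val (v.sum_repr ⟨_, hK⟩)
    rw [AddSubmonoidClass.coe_finsetSum] at hsum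
    simp only at hsum
    rw [← hsum, map_sum]
    refine sum_mem fun s _ => ?_
    rw [Submodule.coe_smul, map_smul]
    exact Submodule.smul_mem _ _ (Submodule.subset_span ⟨(i, s), rfl⟩)
  refine ⟨_, OrthonormalBasis.mk hf hspan, fun i j s => ?_⟩
  simp only [OrthonormalBasis.coe_mk, f]
  rw [← mul_apply_eq_comp, he.mul_same]

/-- Any two unital `*`-representations of a matrix algebra on the same finite-dimensional Hilbert
space are unitarily equivalent. The statement records only the automorphism of the algebra of
operators that a unitary equivalence induces. -/
theorem exists_starAlgEquiv_of_representations (φ ψ : Matrix ι ι ℂ →⋆ₐ[ℂ] (H →L[ℂ] H)) :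
    ∃ Θ : (H →L[ℂ] H) ≃⋆ₐ[ℂ] (H →L[ℂ] H), ∀ M, Θ (φ M) = ψ M := by
  have hφ := isMatrixUnits_single.map φ
  have hψ := isMatrixUnits_single.map ψ
  obtain ⟨r, b, hb⟩ := hφ.exists_orthonormalBasis
  obtain ⟨r', b', hb'⟩ := hψ.exists_orthonormalBasis
  -- Both multiplicities are determined by the dimension of `H`.
  have hr : r = r' := by
    have h := (Module.finrank_eq_card_basis b.toBasis).symm.trans
      (Module.finrank_eq_card_basis b'.toBasis)
    simpa [Fintype.card_ne_zero] using h
  subst hr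
  let U : H ≃ₗᵢ[ℂ] H := b.equiv b' (Equiv.refl _)
  have hU : ∀ a, U (b a) = b' a := fun a => by simp [U]
  have hU' : ∀ a, U.symm (b' a) = b a := fun a => by rw [← hU, U.symm_apply_apply]
  let Θ := U.conjStarAlgEquiv
  refine ⟨Θ, fun M => ?_⟩
  have : (Θ : (H →L[ℂ] H) →⋆ₐ[ℂ] (H →L[ℂ] H)).comp φ = ψ := by
    refine StarAlgHom.ext_matrix fun i j => ?_
    change Θ (φ _) = _
    refine ContinuousLinearMap.coe_injective (b'.toBasis.ext ?_)
    rintro ⟨l, s⟩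
    simp only [OrthonormalBasis.coe_toBasis]
    change U (φ _ (U.symm (b' (l, s)))) = ψ _ (b' (l, s))
    rw [hU']
    by_cases hl : j = l
    · subst hl
      rw [hb, hb', hU]
    · have e1 : φ (Matrix.single i j 1) (b (l, s)) = 0 := by
        rw [← hb l l s, ← mul_apply_eq_comp, hφ.mul_ne _ _ _ _ hl]
        rfl
      have e2 : ψ (Matrix.single i j 1) (b' (l, s)) = 0 := by
        rw [← hb' l l s, ← mul_apply_eq_comp, hψ.mul_ne _ _ _ _ hl]
        rfl
      rw [e1, e2, map_zero]
  exact DFunLike.congr_fun this M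

/-- A form of the Skolem–Noether theorem compatible with the involutions: two unital
`*`-homomorphisms between matrix algebras differ by a `*`-automorphism of the target. -/
theorem exists_starAlgEquiv_matrix {κ : Type*} [Fintype κ] [DecidableEq κ]
    (φ ψ : Matrix ι ι ℂ →⋆ₐ[ℂ] Matrix κ κ ℂ) :
    ∃ Θ : Matrix κ κ ℂ ≃⋆ₐ[ℂ] Matrix κ κ ℂ, ∀ M, Θ (φ M) = ψ M := by
  let τ : Matrix κ κ ℂ ≃⋆ₐ[ℂ] _ := Matrix.toEuclideanCLM (n := κ) (𝕜 := ℂ)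
  let τ' : Matrix κ κ ℂ →⋆ₐ[ℂ] EuclideanSpace ℂ κ →L[ℂ] EuclideanSpace ℂ κ := τ
  obtain ⟨Θ, hΘ⟩ := exists_starAlgEquiv_of_representations
    (τ'.comp φ) (τ'.comp ψ)
  refine ⟨(τ.trans Θ).trans τ.symm, fun M => ?_⟩
  change τ.symm (Θ (τ (φ M))) = ψ M
  rw [τ.symm_apply_eq]
  exact hΘ M

/-- The space on which the target acts is a multiple of the standard representation of the
source. -/
theorem card_dvd_card_of_starAlgHom {κ : Type*} [Fintype κ] [DecidableEq κ]
    (φ : Matrix ι ι ℂ →⋆ₐ[ℂ] Matrix κ κ ℂ) : Fintype.card ι ∣ Fintype.card κ := by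
  let τ : Matrix κ κ ℂ →⋆ₐ[ℂ] EuclideanSpace ℂ κ →L[ℂ] EuclideanSpace ℂ κ :=
    (Matrix.toEuclideanCLM (n := κ) (𝕜 := ℂ) : Matrix κ κ ℂ ≃⋆ₐ[ℂ] _)
  obtain ⟨r, b, -⟩ := (isMatrixUnits_single.map (τ.comp φ)).exists_orthonormalBasis
  have h := Module.finrank_eq_card_basis b.toBasis
  rw [finrank_euclideanSpace, Fintype.card_prod] at h
  exact ⟨_, h⟩

/-- If `k ∣ l`, the `k × k` matrices embed block-diagonally in the `l × l` matrices. -/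
theorem exists_starAlgHom_of_dvd {k l : ℕ} (h : k ∣ l) :
    Nonempty (Matrix (Fin k) (Fin k) ℂ →⋆ₐ[ℂ] Matrix (Fin l) (Fin l) ℂ) := by
  obtain ⟨r, rfl⟩ := h
  let σ : Fin k × Fin r ≃ Fin (k * r) := finProdFinEquiv
  let e : Fin k → Fin k → Matrix (Fin (k * r)) (Fin (k * r)) ℂ :=
    fun i j => ∑ s, Matrix.single (σ (i, s)) (σ (j, s)) 1
  have he : IsMatrixUnits e :=
    { mul_same := fun i j l => by
        simp only [e, Finset.sum_mul, Finset.mul_sum]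
        refine Finset.sum_congr rfl fun s _ => ?_
        rw [Finset.sum_eq_single s]
        · simp
        · intro t _ ht
          exact isMatrixUnits_single.mul_ne _ _ _ _ (by simpa using ht)
        · simp
      mul_ne := fun i j l m h => by
        simp only [e, Finset.sum_mul, Finset.mul_sum]
        refine Finset.sum_eq_zero fun s _ => Finset.sum_eq_zero fun t _ => ?_
        exact isMatrixUnits_single.mul_ne _ _ _ _ (by simp [h])
      star_eq := fun i j => by
        simp only [e, star_sum]
        exact Finset.sum_congr rfl fun s _ => isMatrixUnits_single.star_eq _ _
      sum_eq := by
        rw [← isMatrixUnits_single.sum_eq, ← σ.sum_comp, Fintype.sum_prod_type] }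
  exact ⟨he.lift⟩

end Representations

/-! ### Uniqueness of UHF algebras -/

/-- An increasing sequence of unital `*`-subalgebras `A n`, isomorphic to full matrix algebras of
sizes `k n ≥ 1` with least common multiple `𝔑`. Its union need not be dense in `V`. -/
structure IsUHFTower {V : Type*} [CStarAlgebra V] (𝔑 : SupernaturalNumber)
    (A : ℕ → StarSubalgebra ℂ V) (k : ℕ → ℕ) : Prop where
  mono : Monotone A
  pos : ∀ n, 0 < k n
  iso : ∀ n, Nonempty (A n ≃⋆ₐ[ℂ] Matrix (Fin (k n)) (Fin (k n)) ℂ)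
  exponent : ∀ p : Nat.Primes, 𝔑 p = ⨆ n, ((k n).factorization p : ℕ∞)

open scoped Matrix.Norms.L2Operator in
/-- A matrix algebra is simple, so its unital `*`-homomorphisms into C⋆-algebras are isometric for
the operator norm; the norm of the image therefore does not depend on the homomorphism. -/
theorem norm_starAlgHom_matrix_eq {ι V W : Type*} [Fintype ι] [DecidableEq ι] [Nonempty ι]
    [CStarAlgebra V] [Nontrivial V] [CStarAlgebra W] [Nontrivial W]
    (f : Matrix ι ι ℂ →⋆ₐ[ℂ] V) (g : Matrix ι ι ℂ →⋆ₐ[ℂ] W) (M : Matrix ι ι ℂ) :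
    ‖f M‖ = ‖g M‖ :=
  (NonUnitalStarAlgHom.norm_map f f.injective_of_matrix M).trans
    (NonUnitalStarAlgHom.norm_map g g.injective_of_matrix M).symm

namespace IsUHFTower

variable {V W : Type*} [CStarAlgebra V] [CStarAlgebra W] {𝔑 : SupernaturalNumber}
  {A : ℕ → StarSubalgebra ℂ V} {k : ℕ → ℕ} {B : ℕ → StarSubalgebra ℂ W} {l : ℕ → ℕ}

theorem nontrivial (hA : IsUHFTower 𝔑 A k) : Nontrivial V := by
  obtain ⟨e⟩ := hA.iso 0
  have : Nonempty (Fin (k 0)) := ⟨⟨0, hA.pos 0⟩⟩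
  have : Nontrivial (A 0) := e.symm.injective.nontrivial
  exact (Subtype.val_injective (p := fun x => x ∈ A 0)).nontrivial

/-- The stage `A n` is the range of a unital `*`-homomorphism `f` of matrices, and homomorphisms of
matrix algebras into `A n` factor through `f`. -/
theorem exists_parametrization (hA : IsUHFTower 𝔑 A k) (n : ℕ) :
    ∃ f : Matrix (Fin (k n)) (Fin (k n)) ℂ →⋆ₐ[ℂ] V, f.range = A n ∧
      ∀ (m : ℕ) (g : Matrix (Fin m) (Fin m) ℂ →⋆ₐ[ℂ] V), g.range ≤ A n →
        ∃ j : Matrix (Fin m) (Fin m) ℂ →⋆ₐ[ℂ] Matrix (Fin (k n)) (Fin (k n)) ℂ, f.comp j = g := by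
  obtain ⟨e⟩ := hA.iso n
  refine ⟨(A n).subtype.comp (e.symm : _ →⋆ₐ[ℂ] A n), ?_, fun m g hg => ?_⟩
  · ext x
    constructor
    · rintro ⟨M, rfl⟩
      exact (e.symm M).2
    · intro hx
      exact ⟨e ⟨x, hx⟩, congrArg Subtype.val (e.symm_apply_apply ⟨x, hx⟩)⟩
  · refine ⟨(e : A n →⋆ₐ[ℂ] _).comp (g.codRestrict (A n) fun x => hg ⟨x, rfl⟩), ?_⟩
    ext M
    exact congrArg Subtype.val (e.symm_apply_apply (g.codRestrict (A n) (fun x => hg ⟨x, rfl⟩) M))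

theorem dvd_of_le (hA : IsUHFTower 𝔑 A k) {m n : ℕ} (h : m ≤ n) : k m ∣ k n := by
  obtain ⟨f, hf, -⟩ := hA.exists_parametrization m
  obtain ⟨f', -, hf'⟩ := hA.exists_parametrization n
  obtain ⟨j, -⟩ := hf' _ f (hf.trans_le (hA.mono h))
  have : Nonempty (Fin (k m)) := ⟨⟨0, hA.pos m⟩⟩
  simpa using card_dvd_card_of_starAlgHom j

/-- Every size in one tower eventually divides the sizes in any other tower with the same
supernatural number. -/
theorem exists_dvd (hA : IsUHFTower 𝔑 A k) (hB : IsUHFTower 𝔑 B l) (n : ℕ) :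
    ∃ m₀, ∀ m, m₀ ≤ m → k n ∣ l m := by
  have key : ∀ p : ℕ, p.Prime → ∃ m, (k n).factorization p ≤ (l m).factorization p := by
    intro p hp
    -- Otherwise the exponent of `p` in `𝔑`, as the supremum over `l m`, would be at most one less
    -- than that in `k n`.
    by_contra! hlt
    have h1 : ((k n).factorization p : ℕ∞) ≤ 𝔑 ⟨p, hp⟩ :=
      (le_iSup (fun n => ((k n).factorization p : ℕ∞)) n).trans_eq (hA.exponent ⟨p, hp⟩).symm
    have h2 : 𝔑 ⟨p, hp⟩ ≤ (((k n).factorization p - 1 : ℕ) : ℕ∞) :=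
      (hB.exponent ⟨p, hp⟩).trans_le
        (iSup_le fun m => Nat.cast_le.2 (Nat.le_sub_one_of_lt (hlt m)))
    have h3 := Nat.cast_le.1 (h1.trans h2)
    have h4 := hlt 0
    omega
  choose! m hm using key
  refine ⟨(k n).primeFactors.sup m, fun i hi => ?_⟩
  rw [← Nat.factorization_le_iff_dvd (hA.pos n).ne' (hB.pos i).ne']
  intro p
  by_cases hp : p ∈ (k n).primeFactors
  · have hle : m p ≤ i := (Finset.le_sup hp).trans hi
    exact (hm p (Nat.prime_of_mem_primeFactors hp)).trans
      ((Nat.factorization_le_iff_dvd (hB.pos _).ne' (hB.pos i).ne').2 (hB.dvd_of_le hle) p)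
  · rw [← Nat.support_factorization, Finsupp.notMem_support_iff] at hp
    rw [hp]
    exact Nat.zero_le _

end IsUHFTower

/-- A finite stage of an isomorphism between the unions of `A` and `B`: a matrix algebra embedded
both in some `A n` and in some `B m`. It encodes the isomorphism `f x ↦ g x`. -/
structure PartialIso {V W : Type*} [CStarAlgebra V] [CStarAlgebra W]
    (A : ℕ → StarSubalgebra ℂ V) (B : ℕ → StarSubalgebra ℂ W) where
  /-- The size of the matrices. -/
  size : ℕ
  pos : 0 < size
  /-- The embedding into the first algebra. -/
  f : Matrix (Fin size) (Fin size) ℂ →⋆ₐ[ℂ] V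
  /-- The embedding into the second algebra. -/
  g : Matrix (Fin size) (Fin size) ℂ →⋆ₐ[ℂ] W
  range_f : ∃ n, f.range ≤ A n
  range_g : ∃ m, g.range ≤ B m

namespace PartialIso

variable {V W : Type*} [CStarAlgebra V] [CStarAlgebra W] {𝔑 : SupernaturalNumber}
  {A : ℕ → StarSubalgebra ℂ V} {k : ℕ → ℕ} {B : ℕ → StarSubalgebra ℂ W} {l : ℕ → ℕ}

/-- The inverse partial isomorphism. -/
def symm (p : PartialIso A B) : PartialIso B A where
  size := p.size
  pos := p.pos
  f := p.g
  g := p.f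
  range_f := p.range_g
  range_g := p.range_f

/-- `q` extends `p`: both embeddings of `p` factor through those of `q` in the same way. -/
def Extends (q p : PartialIso A B) : Prop :=
  ∃ j : Matrix (Fin p.size) (Fin p.size) ℂ →⋆ₐ[ℂ] Matrix (Fin q.size) (Fin q.size) ℂ,
    q.f.comp j = p.f ∧ q.g.comp j = p.g

/-- The graph `{(f x, g x)}` of a partial isomorphism. -/
def graph (p : PartialIso A B) : StarSubalgebra ℂ (V × W) := (p.f.prod p.g).range

theorem Extends.graph_le {p q : PartialIso A B} (h : q.Extends p) : p.graph ≤ q.graph := by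
  obtain ⟨j, hf, hg⟩ := h
  rintro _ ⟨M, rfl⟩
  refine ⟨j M, ?_⟩
  have h1 := DFunLike.congr_fun hf M
  have h2 := DFunLike.congr_fun hg M
  exact Prod.ext h1 h2

theorem Extends.trans {p q r : PartialIso A B} (hr : r.Extends q) (hq : q.Extends p) :
    r.Extends p := by
  obtain ⟨j, hf, hg⟩ := hq
  obtain ⟨j', hf', hg'⟩ := hr
  exact ⟨j'.comp j, by rw [← StarAlgHom.comp_assoc, hf', hf],
    by rw [← StarAlgHom.comp_assoc, hg', hg]⟩

theorem Extends.range_f_le {p q : PartialIso A B} (h : q.Extends p) : p.f.range ≤ q.f.range := by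
  obtain ⟨j, hf, -⟩ := h
  rintro _ ⟨M, rfl⟩
  exact ⟨j M, DFunLike.congr_fun hf M⟩

/-- The one-sided extension step. The algebra `A n` embeds in some `B m` because its size divides
that of `B m`; an automorphism of `B m` makes this embedding compatible with the given one. -/
theorem exists_extends_left (hA : IsUHFTower 𝔑 A k) (hB : IsUHFTower 𝔑 B l)
    (p : PartialIso A B) (N : ℕ) : ∃ q : PartialIso A B, q.Extends p ∧ A N ≤ q.f.range := by
  obtain ⟨n₀, hn₀⟩ := p.range_f
  obtain ⟨m₀, hm₀⟩ := p.range_g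
  let n := max n₀ N
  obtain ⟨m₁, hm₁⟩ := hA.exists_dvd hB n
  let m := max m₀ m₁
  obtain ⟨f, hf, hf'⟩ := hA.exists_parametrization n
  obtain ⟨g, hg, hg'⟩ := hB.exists_parametrization m
  obtain ⟨i, hi⟩ := hf' _ p.f (hn₀.trans (hA.mono (le_max_left _ _)))
  obtain ⟨j, hj⟩ := hg' _ p.g (hm₀.trans (hB.mono (le_max_left _ _)))
  obtain ⟨c⟩ := exists_starAlgHom_of_dvd (hm₁ m (le_max_right _ _))
  have : Nonempty (Fin p.size) := ⟨⟨0, p.pos⟩⟩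
  obtain ⟨Θ, hΘ⟩ := exists_starAlgEquiv_matrix (c.comp i) j
  refine ⟨⟨k n, hA.pos n, f, g.comp ((Θ : _ →⋆ₐ[ℂ] Matrix (Fin (l m)) (Fin (l m)) ℂ).comp c),
    ⟨n, hf.le⟩, ⟨m, ?_⟩⟩, ⟨i, hi, ?_⟩, (hA.mono (le_max_right _ _)).trans hf.ge⟩
  · rw [← hg]
    rintro _ ⟨M, rfl⟩
    exact ⟨_, rfl⟩
  · rw [← hj]
    ext M
    exact congrArg g (hΘ M)

theorem exists_extends (hA : IsUHFTower 𝔑 A k) (hB : IsUHFTower 𝔑 B l)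
    (p : PartialIso A B) (N : ℕ) :
    ∃ q : PartialIso A B, q.Extends p ∧ A N ≤ q.f.range ∧ B N ≤ q.g.range := by
  obtain ⟨q, hq, hAq⟩ := exists_extends_left hA hB p N
  obtain ⟨r, ⟨j, hj, hj'⟩, hBr⟩ := exists_extends_left hB hA q.symm N
  have hr : r.symm.Extends q := ⟨j, hj', hj⟩
  exact ⟨r.symm, hr.trans hq, hAq.trans hr.range_f_le, hBr⟩

/-- The scalars provide a partial isomorphism to start from. -/
theorem nonempty (hA : IsUHFTower 𝔑 A k) (hB : IsUHFTower 𝔑 B l) :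
    Nonempty (PartialIso A B) := by
  obtain ⟨f, hf, -⟩ := hA.exists_parametrization 0
  obtain ⟨g, hg, -⟩ := hB.exists_parametrization 0
  obtain ⟨i⟩ := exists_starAlgHom_of_dvd (one_dvd (k 0))
  obtain ⟨j⟩ := exists_starAlgHom_of_dvd (one_dvd (l 0))
  refine ⟨⟨1, one_pos, f.comp i, g.comp j, ⟨0, ?_⟩, ⟨0, ?_⟩⟩⟩
  · rw [← hf]
    rintro _ ⟨M, rfl⟩
    exact ⟨_, rfl⟩
  · rw [← hg]
    rintro _ ⟨M, rfl⟩
    exact ⟨_, rfl⟩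

end PartialIso

/-- An isometric `*`-homomorphism has closed range, so it is onto `S` if its range is dense
there. -/
theorem exists_starAlgEquiv_of_isometry {R V : Type*} [CStarAlgebra R] [CStarAlgebra V]
    (φ : R →⋆ₐ[ℂ] V) (hφ : Isometry φ) {S : StarSubalgebra ℂ V} {D : Set V}
    (hS : (S : Set V) = closure D) (hD : D ⊆ Set.range φ) (hφS : ∀ x, φ x ∈ S) :
    Nonempty (R ≃⋆ₐ[ℂ] S) := by
  refine ⟨StarAlgEquiv.ofBijective (φ.codRestrict S hφS) ⟨fun x y h => ?_, fun y => ?_⟩⟩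
  · exact hφ.injective (congrArg Subtype.val h)
  · have hy : (y : V) ∈ closure D := hS ▸ y.2
    obtain ⟨x, hx⟩ := closure_minimal hD hφ.isClosedEmbedding.isClosed_range hy
    exact ⟨x, Subtype.ext hx⟩

/-- Glimm's theorem: the closed unions of two towers with the same supernatural number are
isomorphic. The isomorphism is obtained from its graph, the closure of the union of the graphs of
an increasing sequence of partial isomorphisms. -/
theorem IsUHFTower.nonempty_starAlgEquiv {V W : Type*} [CStarAlgebra V] [CStarAlgebra W]
    {𝔑 : SupernaturalNumber} {A : ℕ → StarSubalgebra ℂ V} {k : ℕ → ℕ}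
    {B : ℕ → StarSubalgebra ℂ W} {l : ℕ → ℕ} (hA : IsUHFTower 𝔑 A k) (hB : IsUHFTower 𝔑 B l)
    {S : StarSubalgebra ℂ V} {T : StarSubalgebra ℂ W}
    (hS : (S : Set V) = closure (⋃ n, (A n : Set V)))
    (hT : (T : Set W) = closure (⋃ n, (B n : Set W))) : Nonempty (S ≃⋆ₐ[ℂ] T) := by
  have := hA.nontrivial
  have := hB.nontrivial
  obtain ⟨p₀⟩ := PartialIso.nonempty hA hB
  choose next hnext hnextA hnextB using PartialIso.exists_extends hA hB
  let p : ℕ → PartialIso A B := fun n => Nat.rec p₀ (fun n q => next q n) n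
  have hpA : ∀ n, A n ≤ (p (n + 1)).f.range := fun n => hnextA (p n) n
  have hpB : ∀ n, B n ≤ (p (n + 1)).g.range := fun n => hnextB (p n) n
  have hmono : Monotone fun n => (p n).graph :=
    monotone_nat_of_le_succ fun n => (hnext (p n) n).graph_le
  let G := (⨆ n, (p n).graph).topologicalClosure
  have hGc : IsClosed (G : Set (V × W)) := StarSubalgebra.isClosed_topologicalClosure _
  have hG : (G : Set (V × W)) = closure (⋃ n, ((p n).graph : Set (V × W))) := by
    rw [StarSubalgebra.topologicalClosure_coe,
      StarSubalgebra.coe_iSup_of_directed hmono.directed_le]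
  have hle : ∀ n, ∀ x ∈ (p n).graph, x ∈ G := fun n x hx =>
    StarSubalgebra.le_topologicalClosure _ (le_iSup (fun n => (p n).graph) n hx)
  -- Closed conditions need to be checked on the graphs only.
  have hind : ∀ P : V × W → Prop, IsClosed {x | P x} → (∀ n, ∀ M, P ((p n).f M, (p n).g M)) →
      ∀ x ∈ G, P x := by
    intro P hP h x hx
    have hx' : x ∈ closure (⋃ n, ((p n).graph : Set (V × W))) := hG ▸ hx
    refine closure_minimal ?_ hP hx'
    rintro y hy
    obtain ⟨n, M, rfl⟩ := Set.mem_iUnion.1 hy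
    exact h n M
  have hnorm : ∀ x ∈ G, ‖x.1‖ = ‖x.2‖ := by
    refine hind _ (isClosed_eq (by fun_prop) (by fun_prop)) fun n M => ?_
    have : Nonempty (Fin (p n).size) := ⟨⟨0, (p n).pos⟩⟩
    exact norm_starAlgHom_matrix_eq _ _ M
  have hGS : ∀ x ∈ G, x.1 ∈ S := by
    refine hind _ ?_ fun n M => ?_
    · have : IsClosed (S : Set V) := hS ▸ isClosed_closure
      exact this.preimage continuous_fst
    · obtain ⟨m, hm⟩ := (p n).range_f
      have : (p n).f M ∈ (S : Set V) :=
        hS ▸ subset_closure (Set.mem_iUnion.2 ⟨m, hm ⟨M, rfl⟩⟩)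
      exact this
  have hGT : ∀ x ∈ G, x.2 ∈ T := by
    refine hind _ ?_ fun n M => ?_
    · have : IsClosed (T : Set W) := hT ▸ isClosed_closure
      exact this.preimage continuous_snd
    · obtain ⟨m, hm⟩ := (p n).range_g
      have : (p n).g M ∈ (T : Set W) :=
        hT ▸ subset_closure (Set.mem_iUnion.2 ⟨m, hm ⟨M, rfl⟩⟩)
      exact this
  have : IsClosed (G : Set (V × W)) := hGc
  obtain ⟨eS⟩ := exists_starAlgEquiv_of_isometry
    ((StarAlgHom.fst ℂ V W).comp G.subtype)
    (AddMonoidHomClass.isometry_of_norm _ fun x => by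
      change ‖x.1.1‖ = ‖x.1‖
      rw [Prod.norm_def, ← hnorm _ x.2, max_self]) hS
    (Set.iUnion_subset fun n x hx => by
      obtain ⟨M, rfl⟩ := hpA n hx
      exact ⟨⟨((p (n + 1)).f M, (p (n + 1)).g M), hle (n + 1) _ ⟨M, rfl⟩⟩, rfl⟩)
    fun x => hGS _ x.2
  obtain ⟨eT⟩ := exists_starAlgEquiv_of_isometry
    ((StarAlgHom.snd ℂ V W).comp G.subtype)
    (AddMonoidHomClass.isometry_of_norm _ fun x => by
      change ‖x.1.2‖ = ‖x.1‖
      rw [Prod.norm_def, hnorm _ x.2, max_self]) hT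
    (Set.iUnion_subset fun n x hx => by
      obtain ⟨M, rfl⟩ := hpB n hx
      exact ⟨⟨((p (n + 1)).f M, (p (n + 1)).g M), hle (n + 1) _ ⟨M, rfl⟩⟩, rfl⟩)
    fun x => hGT _ x.2
  exact ⟨eS.symm.trans eT⟩

/-! ### Multiplication operators and shifts -/

/-- The `*`-algebra of essentially bounded functions, not identified almost everywhere. -/
def essBoundedFunctions : StarSubalgebra ℂ (UnitAddCircle → ℂ) where
  carrier := {S | MemLp S ∞ volume}
  mul_mem' hS hT := hT.mul hS
  one_mem' := memLp_top_const 1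
  add_mem' hS hT := hS.add hT
  zero_mem' := memLp_top_const 0
  algebraMap_mem' r := memLp_top_const r
  star_mem' hS := hS.star

/-- Multiplication operators, as a `*`-representation of the essentially bounded functions. -/
noncomputable def multHom : essBoundedFunctions →⋆ₐ[ℂ] (L2Circle →L[ℂ] L2Circle) where
  toFun S := multOp (S.2.toLp S.1)
  map_one' := by
    ext u
    filter_upwards [multOp_coeFn (S := 1) (memLp_top_const 1) u] with x h
    rw [one_apply_eq_self]
    exact h.trans (one_mul _)
  map_zero' := by
    ext u
    filter_upwards [multOp_coeFn (S := 0) (memLp_top_const 0) u, Lp.coeFn_zero ℂ 2 volume]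
      with x h h0
    refine h.trans ((zero_mul _).trans ?_)
    exact h0.symm
  map_add' S T := by
    ext u
    rw [add_apply]
    filter_upwards [multOp_coeFn (S + T).2 u, multOp_coeFn S.2 u, multOp_coeFn T.2 u,
      Lp.coeFn_add (multOp (S.2.toLp S.1) u) (multOp (T.2.toLp T.1) u)] with x h hS hT ha
    rw [h, ha, Pi.add_apply, hS, hT]
    exact add_mul _ _ _
  map_mul' S T := by
    ext u
    rw [mul_apply_eq_comp]
    filter_upwards [multOp_coeFn (S * T).2 u, multOp_coeFn S.2 (multOp (T.2.toLp T.1) u),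
      multOp_coeFn T.2 u] with x h hS hT
    rw [h, hS, hT]
    exact mul_assoc _ _ _
  commutes' r := by
    ext u
    rw [Algebra.algebraMap_eq_smul_one (A := L2Circle →L[ℂ] L2Circle), smul_apply,
      one_apply_eq_self]
    filter_upwards [multOp_coeFn (memLp_top_const r) u, Lp.coeFn_smul r u] with x h hr
    rw [hr]
    exact h
  map_star' S := (star_multOp S.2 S.2.star).symm

theorem norm_multHom_le (S : essBoundedFunctions) {C : ℝ} (hC : 0 ≤ C) (h : ∀ x, ‖S.1 x‖ ≤ C) :
    ‖multHom S‖ ≤ C := by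
  refine ContinuousLinearMap.opNorm_le_bound _ hC fun u => Lp.norm_le_mul_norm_of_ae_le_mul ?_
  filter_upwards [multOp_coeFn S.2 u] with x hx
  change ‖(multOp (S.2.toLp S.1) u : UnitAddCircle → ℂ) x‖ ≤ _
  rw [hx, norm_mul]
  exact mul_le_mul_of_nonneg_right (h x) (norm_nonneg _)

/-- Translation of functions on the circle. -/
def shiftFun (t : UnitAddCircle) (S : essBoundedFunctions) : essBoundedFunctions :=
  ⟨fun x => S.1 (x + t), S.2.comp_measurePreserving (measurePreserving_add_right volume t)⟩

theorem shiftOp_mul_multHom (t : UnitAddCircle) (S : essBoundedFunctions) :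
    shiftOp t * multHom S = multHom (shiftFun t S) * shiftOp t := by
  ext u
  rw [mul_apply_eq_comp, mul_apply_eq_comp]
  have h1 := (measurePreserving_add_right volume t).quasiMeasurePreserving.ae
    (multOp_coeFn S.2 u)
  filter_upwards [shiftOp_coeFn t (multHom S u), shiftOp_coeFn t u, h1,
    multOp_coeFn (shiftFun t S).2 (shiftOp t u)] with x h h2 h3 h4
  rw [h]
  refine h3.trans (Eq.trans ?_ h4.symm)
  rw [h2]
  rfl

theorem multHom_shiftFun_mem {T : StarSubalgebra ℂ (L2Circle →L[ℂ] L2Circle)} {t : UnitAddCircle}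
    {S : essBoundedFunctions} (ht : shiftOp t ∈ T) (hS : multHom S ∈ T) :
    multHom (shiftFun t S) ∈ T := by
  have : multHom (shiftFun t S) = shiftOp t * multHom S * star (shiftOp t) := by
    rw [shiftOp_mul_multHom, mul_assoc, star_shiftOp, ← shiftOp_add, add_neg_cancel, shiftOp_zero,
      mul_one]
  rw [this]
  exact mul_mem (mul_mem ht hS) (star_mem ht)

theorem shiftOp_zsmul_mem {T : StarSubalgebra ℂ (L2Circle →L[ℂ] L2Circle)} {t : UnitAddCircle}
    (ht : shiftOp t ∈ T) (m : ℤ) : shiftOp (m • t) ∈ T := by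
  obtain ⟨n, rfl | rfl⟩ := m.eq_nat_or_neg
  · rw [natCast_zsmul, shiftOp_nsmul]
    exact pow_mem ht n
  · rw [neg_smul, natCast_zsmul, ← star_shiftOp, shiftOp_nsmul]
    exact star_mem (pow_mem ht n)

theorem shiftOp_div_mem {T : StarSubalgebra ℂ (L2Circle →L[ℂ] L2Circle)} {n : ℕ}
    (hT : shiftOp ((1 / n : ℝ) : UnitAddCircle) ∈ T) (m : ℤ) :
    shiftOp ((m / n : ℝ) : UnitAddCircle) ∈ T := by
  have : ((m / n : ℝ) : UnitAddCircle) = m • ((1 / n : ℝ) : UnitAddCircle) := by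
    rw [← AddCircle.coe_zsmul, zsmul_eq_mul, mul_one_div]
  rw [this]
  exact shiftOp_zsmul_mem hT m

theorem nontrivial_L2Circle : Nontrivial L2Circle := by
  refine ⟨⟨(memLp_const (1 : ℂ)).toLp _, 0, fun h => ?_⟩⟩
  obtain ⟨x, hx⟩ := ((memLp_const (1 : ℂ)).coeFn_toLp.symm.trans
    (h ▸ Lp.coeFn_zero ℂ 2 (volume : Measure UnitAddCircle))).exists
  exact one_ne_zero hx

/-! ### Arcs with end points in a grid -/

theorem UnitAddCircle.coe_eq_coe_iff {s t : ℝ} :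
    (s : UnitAddCircle) = t ↔ ∃ z : ℤ, s = t + z := by
  rw [← sub_eq_zero, ← AddCircle.coe_sub, AddCircle.coe_eq_zero_iff]
  refine exists_congr fun z => ?_
  rw [zsmul_eq_mul, mul_one, eq_sub_iff_add_eq, add_comm, eq_comm]

theorem coe_mem_arc_iff {p q t : ℝ} :
    (t : UnitAddCircle) ∈ arc p q ↔ ∃ z : ℤ, p ≤ t + z ∧ t + z < q := by
  constructor
  · rintro ⟨s, hs, h⟩
    obtain ⟨z, rfl⟩ := UnitAddCircle.coe_eq_coe_iff.1 h
    exact ⟨z, hs⟩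
  · rintro ⟨z, hz⟩
    exact ⟨t + z, hz, UnitAddCircle.coe_eq_coe_iff.2 ⟨z, rfl⟩⟩

theorem add_coe_mem_arc_iff {p q c : ℝ} {x : UnitAddCircle} :
    x + (c : UnitAddCircle) ∈ arc p q ↔ x ∈ arc (p - c) (q - c) := by
  obtain ⟨t, rfl⟩ := QuotientAddGroup.mk_surjective x
  change ((t + c : ℝ) : UnitAddCircle) ∈ arc p q ↔ (t : UnitAddCircle) ∈ _
  rw [coe_mem_arc_iff, coe_mem_arc_iff]
  refine exists_congr fun z => ?_
  constructor <;> rintro ⟨h1, h2⟩ <;> constructor <;> linarith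

/-- Membership in an arc with end points in the grid `(1 / n) ℤ` depends only on the cell of the
grid that contains the point. -/
theorem coe_mem_arc_div_iff {n : ℕ} (hn : 0 < n) {a b : ℤ} {t : ℝ} :
    (t : UnitAddCircle) ∈ arc (a / n) (b / n) ↔
      ∃ z : ℤ, a ≤ ⌊n * t⌋ + n * z ∧ ⌊n * t⌋ + n * z < b := by
  have hn' : (0 : ℝ) < n := by exact_mod_cast hn
  rw [coe_mem_arc_iff]
  refine exists_congr fun z => ?_
  have h : ⌊n * t⌋ + n * z = ⌊n * (t + z)⌋ := by
    rw [mul_add, ← Int.cast_natCast, ← Int.cast_mul, Int.floor_add_intCast, Int.cast_natCast]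
  rw [h, Int.le_floor, Int.floor_lt, div_le_iff₀ hn', lt_div_iff₀ hn', mul_comm (n : ℝ)]

/-- The indicator function of an arc. -/
noncomputable def arcIndicator (p q : ℝ) : essBoundedFunctions :=
  ⟨(arc p q).indicator 1, memLp_top_of_bound
    (measurable_one.indicator (measurableSet_arc p q)).aestronglyMeasurable 1
    (Filter.Eventually.of_forall fun x => by by_cases hx : x ∈ arc p q <;> simp [hx])⟩

theorem shiftFun_arcIndicator (p q c : ℝ) :
    shiftFun (c : UnitAddCircle) (arcIndicator p q) = arcIndicator (p - c) (q - c) := by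
  ext x
  change (arc p q).indicator 1 (x + (c : UnitAddCircle)) = (arc (p - c) (q - c)).indicator 1 x
  by_cases h : x ∈ arc (p - c) (q - c)
  · rw [Set.indicator_of_mem h, Set.indicator_of_mem (add_coe_mem_arc_iff.2 h)]
    rfl
  · rw [Set.indicator_of_notMem h, Set.indicator_of_notMem (mt add_coe_mem_arc_iff.1 h)]

theorem star_arcIndicator (p q : ℝ) : star (arcIndicator p q) = arcIndicator p q := by
  ext x
  change star ((arc p q).indicator (1 : UnitAddCircle → ℂ) x) = (arc p q).indicator 1 x
  by_cases h : x ∈ arc p q <;> simp [h]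

/-- The indicator function of the cell `[i / n, (i + 1) / n)`. -/
noncomputable def cellIndicator (n : ℕ) (i : ℤ) : essBoundedFunctions :=
  arcIndicator ((i : ℝ) / n) (((i + 1 : ℤ) : ℝ) / n)

theorem cellIndicator_coe {n : ℕ} (hn : 0 < n) (i : Fin n) (t : ℝ) :
    (cellIndicator n i).1 (t : UnitAddCircle) = if ⌊n * t⌋ % n = i then 1 else 0 := by
  have : (t : UnitAddCircle) ∈ arc (((i : ℤ) : ℝ) / n) (((i + 1 : ℤ) : ℝ) / n) ↔
      ⌊n * t⌋ % n = i := by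
    rw [coe_mem_arc_div_iff hn]
    have hi : (i : ℤ) < n := by exact_mod_cast i.2
    constructor
    · rintro ⟨z, h1, h2⟩
      have : ⌊n * t⌋ + n * z = i := by omega
      rw [← Int.add_mul_emod_self_left _ (n : ℤ) z, this]
      exact Int.emod_eq_of_lt (by positivity) hi
    · intro h
      refine ⟨-(⌊n * t⌋ / n), ?_⟩
      have := Int.emod_add_mul_ediv ⌊n * t⌋ n
      rw [mul_neg]
      omega
  classical
  change (arc _ _).indicator 1 (t : UnitAddCircle) = _
  rw [Set.indicator_apply]
  simp only [this]
  rfl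

theorem essBoundedFunctions_ext {S T : essBoundedFunctions}
    (h : ∀ t : ℝ, S.1 (t : UnitAddCircle) = T.1 (t : UnitAddCircle)) : S = T := by
  refine Subtype.ext (funext fun x => ?_)
  obtain ⟨t, rfl⟩ := QuotientAddGroup.mk_surjective x
  exact h t

theorem arcIndicator_mul_self (p q : ℝ) :
    arcIndicator p q * arcIndicator p q = arcIndicator p q := by
  ext x
  change (arc p q).indicator (1 : UnitAddCircle → ℂ) x * (arc p q).indicator 1 x =
    (arc p q).indicator 1 x
  by_cases h : x ∈ arc p q <;> simp [h]

theorem cellIndicator_mul_of_ne {n : ℕ} (hn : 0 < n) {i j : Fin n} (h : i ≠ j) :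
    cellIndicator n i * cellIndicator n j = 0 := by
  refine essBoundedFunctions_ext fun t => ?_
  change (cellIndicator n i).1 t * (cellIndicator n j).1 t = 0
  rw [cellIndicator_coe hn, cellIndicator_coe hn]
  by_cases hi : ⌊n * t⌋ % n = i
  · have : ⌊n * t⌋ % n ≠ j := fun hj => h (Fin.ext (by exact_mod_cast hi.symm.trans hj))
    rw [if_neg this, mul_zero]
  · rw [if_neg hi, zero_mul]

/-- A combination of cell indicators takes at each point the coefficient of the cell, numbered
modulo `n`, that contains the point. -/
theorem sum_smul_cellIndicator_coe {n : ℕ} (hn : 0 < n) (c : ℤ → ℂ) (t : ℝ) :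
    (∑ i : Fin n, c i • cellIndicator n i).1 (t : UnitAddCircle) = c (⌊n * t⌋ % n) := by
  have h0 : (0 : ℤ) < n := by exact_mod_cast hn
  have h1 := Int.emod_nonneg ⌊n * t⌋ h0.ne'
  have h2 := Int.emod_lt_of_pos ⌊n * t⌋ h0
  obtain ⟨i, hi⟩ := Int.eq_ofNat_of_zero_le h1
  have hin : i < n := by omega
  have hsum : (∑ i : Fin n, c i • cellIndicator n i).1 (t : UnitAddCircle) =
      ∑ i : Fin n, c i * (cellIndicator n i).1 (t : UnitAddCircle) := by
    rw [AddSubmonoidClass.coe_finsetSum, Finset.sum_apply]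
    rfl
  rw [hsum, Finset.sum_eq_single ⟨i, hin⟩]
  · rw [cellIndicator_coe hn, hi]
    simp
  · intro j _ hj
    rw [cellIndicator_coe hn, hi, if_neg, mul_zero]
    exact fun h => hj (Fin.ext (by exact_mod_cast h.symm))
  · simp

theorem sum_cellIndicator {n : ℕ} (hn : 0 < n) : ∑ i : Fin n, cellIndicator n i = 1 := by
  refine essBoundedFunctions_ext fun t => ?_
  simpa using sum_smul_cellIndicator_coe hn (fun _ => 1) t

theorem exists_arcIndicator_eq_sum {n : ℕ} (hn : 0 < n) (a b : ℤ) :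
    ∃ c : ℤ → ℂ, arcIndicator ((a : ℝ) / n) ((b : ℝ) / n) =
      ∑ i : Fin n, c i • cellIndicator n i := by
  classical
  let c : ℤ → ℂ := fun i => if ∃ z : ℤ, a ≤ i + n * z ∧ i + n * z < b then 1 else 0
  refine ⟨c, essBoundedFunctions_ext fun t => ?_⟩
  refine Eq.trans ?_ (sum_smul_cellIndicator_coe hn c t).symm
  change (arc _ _).indicator 1 (t : UnitAddCircle) = _
  rw [Set.indicator_apply]
  have : (t : UnitAddCircle) ∈ arc ((a : ℝ) / n) ((b : ℝ) / n) ↔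
      ∃ z : ℤ, a ≤ ⌊n * t⌋ % n + n * z ∧ ⌊n * t⌋ % n + n * z < b := by
    rw [coe_mem_arc_div_iff hn]
    have hm := Int.emod_add_mul_ediv ⌊n * t⌋ n
    constructor
    · rintro ⟨z, hz⟩
      refine ⟨z + ⌊n * t⌋ / n, ?_⟩
      rw [mul_add]
      omega
    · rintro ⟨z, hz⟩
      refine ⟨z - ⌊n * t⌋ / n, ?_⟩
      rw [mul_sub]
      omega
  simp only [this]
  rfl

/-! ### The matrix algebra of a grid -/

/-- The operator that moves functions supported in the cell `[j / n, (j + 1) / n)` to the cell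
`[i / n, (i + 1) / n)` by translation, and kills functions supported outside the former cell. -/
noncomputable def gridUnit (n : ℕ) (i j : Fin n) : L2Circle →L[ℂ] L2Circle :=
  multHom (cellIndicator n i) * shiftOp ((((j - i : ℤ) : ℝ) / n : ℝ) : UnitAddCircle)

theorem multHom_cellIndicator_mul_shiftOp (n : ℕ) (i m : ℤ) :
    multHom (cellIndicator n i) * shiftOp (((m : ℝ) / n : ℝ) : UnitAddCircle) =
      shiftOp (((m : ℝ) / n : ℝ) : UnitAddCircle) * multHom (cellIndicator n (i + m)) := by
  rw [shiftOp_mul_multHom, cellIndicator, cellIndicator, shiftFun_arcIndicator]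
  congr 3
  · push_cast; ring
  · push_cast; ring

theorem gridUnit_eq (n : ℕ) (i j : Fin n) : gridUnit n i j =
    shiftOp ((((j - i : ℤ) : ℝ) / n : ℝ) : UnitAddCircle) * multHom (cellIndicator n j) := by
  rw [gridUnit, multHom_cellIndicator_mul_shiftOp, add_sub_cancel]

theorem shiftOp_div_mul_shiftOp_div (n : ℕ) (a b : ℤ) :
    shiftOp (((a : ℝ) / n : ℝ) : UnitAddCircle) * shiftOp (((b : ℝ) / n : ℝ) : UnitAddCircle) =
      shiftOp ((((a + b : ℤ) : ℝ) / n : ℝ) : UnitAddCircle) := by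
  rw [← shiftOp_add, ← AddCircle.coe_add, ← add_div, Int.cast_add]

theorem gridUnit_self (n : ℕ) (i : Fin n) : gridUnit n i i = multHom (cellIndicator n i) := by
  rw [gridUnit, sub_self, Int.cast_zero, zero_div, AddCircle.coe_zero, shiftOp_zero, mul_one]

theorem isMatrixUnits_gridUnit {n : ℕ} (hn : 0 < n) : IsMatrixUnits (gridUnit n) where
  mul_same i j k := by
    rw [gridUnit_eq n i j, gridUnit, mul_assoc, ← mul_assoc (multHom _), ← map_mul,
      cellIndicator, arcIndicator_mul_self, ← cellIndicator, ← mul_assoc, ← gridUnit_eq, gridUnit,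
      mul_assoc, shiftOp_div_mul_shiftOp_div, gridUnit, sub_add_sub_cancel']
  mul_ne i j k l h := by
    rw [gridUnit_eq n i j, gridUnit, mul_assoc, ← mul_assoc (multHom _), ← map_mul,
      cellIndicator_mul_of_ne hn h, map_zero, zero_mul, mul_zero]
  star_eq i j := by
    rw [gridUnit_eq n i j, gridUnit, star_mul, ← map_star, cellIndicator, star_arcIndicator,
      star_shiftOp, ← AddCircle.coe_neg, ← neg_div, ← Int.cast_neg, neg_sub, ← cellIndicator]
  sum_eq := by
    simp only [gridUnit_self]
    rw [← map_sum, sum_cellIndicator hn, map_one]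

/-- The `*`-algebra, isomorphic to the `n × n` matrices, of the operators on `L²(𝕋)` that permute
and recombine the cells of the grid `(1 / n) ℤ` by translations. -/
noncomputable def gridAlgebra {n : ℕ} (hn : 0 < n) : StarSubalgebra ℂ (L2Circle →L[ℂ] L2Circle) :=
  (isMatrixUnits_gridUnit hn).lift.range

theorem nonempty_gridAlgebra_equiv {n : ℕ} (hn : 0 < n) :
    Nonempty (gridAlgebra hn ≃⋆ₐ[ℂ] Matrix (Fin n) (Fin n) ℂ) := by
  have : Nonempty (Fin n) := ⟨⟨0, hn⟩⟩
  have := nontrivial_L2Circle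
  exact ⟨(StarAlgEquiv.ofInjective _ (isMatrixUnits_gridUnit hn).lift.injective_of_matrix).symm⟩

theorem gridUnit_mem {n : ℕ} (hn : 0 < n) (i j : Fin n) : gridUnit n i j ∈ gridAlgebra hn :=
  ⟨Matrix.single i j 1, (isMatrixUnits_gridUnit hn).lift_single i j⟩

theorem multHom_arcIndicator_mem_gridAlgebra {n : ℕ} (hn : 0 < n) (a b : ℤ) :
    multHom (arcIndicator ((a : ℝ) / n) ((b : ℝ) / n)) ∈ gridAlgebra hn := by
  obtain ⟨c, hc⟩ := exists_arcIndicator_eq_sum hn a b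
  rw [hc, map_sum]
  refine sum_mem fun i _ => ?_
  rw [map_smul, ← gridUnit_self]
  exact (gridAlgebra hn).toSubalgebra.smul_mem (gridUnit_mem hn i i) _

/-- Restricted to the cell `i`, the shift by `m / n` is the matrix unit that connects this cell
with the cell `i + m` modulo `n`. -/
theorem shiftOp_mem_gridAlgebra {n : ℕ} (hn : 0 < n) (m : ℤ) :
    shiftOp (((m : ℝ) / n : ℝ) : UnitAddCircle) ∈ gridAlgebra hn := by
  have hn0 : (n : ℝ) ≠ 0 := by exact_mod_cast hn.ne'
  rw [← one_mul (shiftOp _), ← map_one multHom, ← sum_cellIndicator hn, map_sum, Finset.sum_mul]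
  refine sum_mem fun i _ => ?_
  have h0 : (0 : ℤ) < n := by exact_mod_cast hn
  have h1 := Int.emod_nonneg (i + m) h0.ne'
  have h2 := Int.emod_lt_of_pos (i + m) h0
  obtain ⟨j, hj⟩ := Int.eq_ofNat_of_zero_le h1
  have hjn : j < n := by omega
  have hm := Int.emod_add_mul_ediv (i + m) n
  have : (((m : ℝ) / n : ℝ) : UnitAddCircle) = ((((j - i : ℤ) : ℝ) / n : ℝ) : UnitAddCircle) := by
    refine UnitAddCircle.coe_eq_coe_iff.2 ⟨(i + m) / n, ?_⟩
    rw [div_eq_iff hn0, add_mul, div_mul_cancel₀ _ hn0]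
    have : m = j - i + (i + m) / n * n := by
      rw [mul_comm]
      change (i + m) % n = (j : ℤ) at hj
      omega
    exact_mod_cast this
  rw [this]
  exact gridUnit_mem hn i ⟨j, hjn⟩

/-- The algebra of a grid is generated by the shift by one cell and the indicator function of one
cell. -/
theorem gridAlgebra_le {n : ℕ} (hn : 0 < n) {T : StarSubalgebra ℂ (L2Circle →L[ℂ] L2Circle)}
    (hs : shiftOp ((1 / n : ℝ) : UnitAddCircle) ∈ T)
    (hc : multHom (cellIndicator n 0) ∈ T) : gridAlgebra hn ≤ T := by
  refine (isMatrixUnits_gridUnit hn).range_lift_le fun i j => mul_mem ?_ (shiftOp_div_mem hs _)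
  have h := multHom_shiftFun_mem (shiftOp_div_mem hs (-i)) hc
  rw [cellIndicator, shiftFun_arcIndicator] at h
  convert h using 2
  rw [cellIndicator]
  congr 1
  · push_cast; ring
  · push_cast; ring

theorem gridAlgebra_mono {m n : ℕ} (hm : 0 < m) (hn : 0 < n) (h : m ∣ n) :
    gridAlgebra hm ≤ gridAlgebra hn := by
  obtain ⟨r, rfl⟩ := h
  have hm0 : (m : ℝ) ≠ 0 := by exact_mod_cast hm.ne'
  have hr0 : (r : ℝ) ≠ 0 := by
    rintro h
    simp [Nat.cast_eq_zero.1 h] at hn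
  refine gridAlgebra_le hm ?_ ?_
  · convert shiftOp_mem_gridAlgebra hn r using 3
    push_cast
    field_simp
  · convert multHom_arcIndicator_mem_gridAlgebra hn 0 r using 2
    rw [cellIndicator]
    congr 1
    · simp
    · push_cast
      field_simp

/-! ### Divisors of supernatural numbers -/

namespace SupernaturalNumber

variable {𝔑 : SupernaturalNumber}

theorem isDivisor_one : IsDivisor 1 𝔑 := ⟨one_pos, fun p => by simp⟩

theorem IsDivisor.lcm {m n : ℕ} (hm : IsDivisor m 𝔑) (hn : IsDivisor n 𝔑) :
    IsDivisor (m.lcm n) 𝔑 := by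
  refine ⟨Nat.lcm_pos hm.1 hn.1, fun p => ?_⟩
  rw [Nat.factorization_lcm hm.1.ne' hn.1.ne', Finsupp.sup_apply]
  rcases max_choice (m.factorization p) (n.factorization p) with h | h
  · exact (congrArg _ h).trans_le (hm.2 p)
  · exact (congrArg _ h).trans_le (hn.2 p)

theorem IsDivisor.of_dvd {m n : ℕ} (hn : IsDivisor n 𝔑) (h : m ∣ n) : IsDivisor m 𝔑 := by
  have hm := Nat.pos_of_dvd_of_pos h hn.1
  exact ⟨hm, fun p => le_trans
    (Nat.cast_le.2 ((Nat.factorization_le_iff_dvd hm.ne' hn.1.ne').2 h p)) (hn.2 p)⟩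

theorem isDivisor_prime_pow {p : Nat.Primes} {j : ℕ} : IsDivisor ((p : ℕ) ^ j) 𝔑 ↔ j ≤ 𝔑 p := by
  constructor
  · intro h
    simpa [p.2.factorization_pow] using h.2 p
  · refine fun h => ⟨pow_pos p.2.pos j, fun q => ?_⟩
    rw [p.2.factorization_pow, Finsupp.single_apply]
    split_ifs with hq
    · rwa [← Subtype.ext hq]
    · exact zero_le

theorem isDivisor_of_mem_primePowers {q : ℕ} (h : q ∈ primePowers 𝔑) : IsDivisor q 𝔑 := by
  obtain ⟨p, j, -, hj, rfl⟩ := h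
  exact isDivisor_prime_pow.2 hj

theorem prime_pow_mem_primePowers {p j : ℕ} (hp : p.Prime) (hj : 1 ≤ j)
    (h : IsDivisor (p ^ j) 𝔑) : p ^ j ∈ primePowers 𝔑 :=
  ⟨⟨p, hp⟩, j, hj, isDivisor_prime_pow.1 h, rfl⟩

open Classical in
/-- A sequence of divisors of `𝔑`, each dividing the next, such that every divisor of `𝔑` divides
some term: the least common multiple of the divisors that are at most `m`. -/
noncomputable def divisorSeq (𝔑 : SupernaturalNumber) (m : ℕ) : ℕ :=
  ((Finset.range (m + 1)).filter fun n => IsDivisor n 𝔑).lcm id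

theorem isDivisor_divisorSeq (𝔑 : SupernaturalNumber) (m : ℕ) : IsDivisor (𝔑.divisorSeq m) 𝔑 := by
  classical
  have key : ∀ s : Finset ℕ, (∀ n ∈ s, IsDivisor n 𝔑) → IsDivisor (s.lcm id) 𝔑 := by
    intro s
    induction s using Finset.induction_on with
    | empty => exact fun _ => isDivisor_one
    | insert n s _ ih =>
      intro h
      rw [Finset.lcm_insert]
      exact (h n (by simp)).lcm (ih fun k hk => h k (by simp [hk]))
  exact key _ (by simp)

theorem divisorSeq_dvd_of_le (𝔑 : SupernaturalNumber) {m n : ℕ} (h : m ≤ n) :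
    𝔑.divisorSeq m ∣ 𝔑.divisorSeq n := by
  classical
  refine Finset.lcm_mono fun k hk => ?_
  simp only [Finset.mem_filter, Finset.mem_range] at hk ⊢
  exact ⟨by omega, hk.2⟩

theorem IsDivisor.dvd_divisorSeq {n : ℕ} (h : IsDivisor n 𝔑) : n ∣ 𝔑.divisorSeq n := by
  classical
  exact Finset.dvd_lcm (f := id) (by simp [h])

theorem eq_iSup_factorization_divisorSeq (𝔑 : SupernaturalNumber) (p : Nat.Primes) :
    𝔑 p = ⨆ m, ((𝔑.divisorSeq m).factorization p : ℕ∞) := by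
  refine le_antisymm (ENat.forall_natCast_le_iff_le.1 fun j hj => ?_)
    (iSup_le fun m => (isDivisor_divisorSeq 𝔑 m).2 p)
  have h := isDivisor_prime_pow.2 hj
  refine le_trans ?_ (le_iSup (fun m => ((𝔑.divisorSeq m).factorization p : ℕ∞)) ((p : ℕ) ^ j))
  exact Nat.cast_le.2 ((p.2.pow_dvd_iff_le_factorization
    (isDivisor_divisorSeq 𝔑 _).1.ne').1 h.dvd_divisorSeq)

end SupernaturalNumber

/-- The grid algebras along a cofinal sequence of divisors of `𝔑`. -/
noncomputable def gridTower (𝔑 : SupernaturalNumber) (m : ℕ) :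
    StarSubalgebra ℂ (L2Circle →L[ℂ] L2Circle) :=
  gridAlgebra (𝔑.isDivisor_divisorSeq m).1

theorem isUHFTower_gridTower (𝔑 : SupernaturalNumber) :
    IsUHFTower 𝔑 (gridTower 𝔑) 𝔑.divisorSeq where
  mono _ _ h := gridAlgebra_mono _ _ (𝔑.divisorSeq_dvd_of_le h)
  pos m := (𝔑.isDivisor_divisorSeq m).1
  iso _ := nonempty_gridAlgebra_equiv _
  exponent := 𝔑.eq_iSup_factorization_divisorSeq

theorem gridAlgebra_le_gridTower {𝔑 : SupernaturalNumber} {n : ℕ}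
    (h : SupernaturalNumber.IsDivisor n 𝔑) : gridAlgebra h.1 ≤ gridTower 𝔑 n :=
  gridAlgebra_mono _ _ h.dvd_divisorSeq

/-! ### The algebra of finite differential operators as a UHF algebra -/

theorem mem_fdAlgebra_of_mem_fdGenerators {Q : Set ℕ} {B : Set UnitAddCircle}
    {T : L2Circle →L[ℂ] L2Circle} (h : T ∈ fdGenerators Q B) : T ∈ fdAlgebra Q B :=
  subset_closure (Algebra.subset_adjoin h)

theorem shiftOp_eq_smul_finiteDerivative {h : ℝ} (hh : h ≠ 0) :
    shiftOp (h : UnitAddCircle) = (h : ℂ) • finiteDerivative h + 1 := by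
  rw [finiteDerivative, smul_smul, mul_inv_cancel₀ (by exact_mod_cast hh), one_smul,
    sub_add_cancel]

theorem shiftOp_inv_mem_fdAlgebra {Q : Set ℕ} {B : Set UnitAddCircle} {q : ℕ} (hq : q ∈ Q)
    (h0 : 0 < q) : shiftOp ((1 / q : ℝ) : UnitAddCircle) ∈ fdAlgebra Q B := by
  have hq0 : (q : ℝ) ≠ 0 := by exact_mod_cast h0.ne'
  rw [shiftOp_eq_smul_finiteDerivative (one_div_ne_zero hq0)]
  exact add_mem ((fdAlgebra Q B).toSubalgebra.smul_mem
    (mem_fdAlgebra_of_mem_fdGenerators (Or.inl ⟨q, hq, rfl⟩)) _) (one_mem _)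

theorem multHom_mem_fdAlgebra {Q : Set ℕ} {B : Set UnitAddCircle} {S : essBoundedFunctions}
    (hS : IsRegulated B S.1) : multHom S ∈ fdAlgebra Q B :=
  mem_fdAlgebra_of_mem_fdGenerators (Or.inr ⟨S.1, hS, rfl⟩)

theorem isRegulated_of_mem_stepFunctions {B : Set UnitAddCircle} {s : UnitAddCircle → ℂ}
    (hs : s ∈ stepFunctions B) : IsRegulated B s :=
  fun ε hε => ⟨s, hs, fun x => by simpa using hε.le⟩

/-- By Bézout's identity, the shifts by `p ^ (-j)` with `p ^ j` dividing `𝔑` generate the shifts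
by `1 / n` with `n` dividing `𝔑`. -/
theorem shiftOp_inv_mem_of_isDivisor {𝔑 : SupernaturalNumber} {B : Set UnitAddCircle} (n : ℕ) :
    SupernaturalNumber.IsDivisor n 𝔑 →
      shiftOp ((1 / n : ℝ) : UnitAddCircle) ∈ fdAlgebra (primePowers 𝔑) B := by
  induction n using Nat.recOnPosPrimePosCoprime with
  | prime_pow p j hp hj =>
    intro h
    exact shiftOp_inv_mem_fdAlgebra (SupernaturalNumber.prime_pow_mem_primePowers hp hj h) h.1
  | zero => exact fun h => absurd h.1 (lt_irrefl 0)
  | one =>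
    intro _
    have : ((1 / ((1 : ℕ) : ℝ) : ℝ) : UnitAddCircle) = 0 := by
      rw [Nat.cast_one, div_one]
      exact AddCircle.coe_period 1
    rw [this, shiftOp_zero]
    exact one_mem _
  | coprime a b ha hb hab iha ihb =>
    intro h
    obtain ⟨u, v, huv⟩ := Nat.isCoprime_iff_coprime.2 hab
    have ha0 : (a : ℝ) ≠ 0 := by exact_mod_cast (by omega : a ≠ 0)
    have hb0 : (b : ℝ) ≠ 0 := by exact_mod_cast (by omega : b ≠ 0)
    have huv' : (u : ℝ) * a + v * b = 1 := by exact_mod_cast huv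
    have : (1 / ((a * b : ℕ) : ℝ) : ℝ) = v / a + u / b := by
      rw [← huv']
      push_cast
      field_simp
      ring
    rw [this, AddCircle.coe_add, shiftOp_add]
    exact mul_mem (shiftOp_div_mem (iha (h.of_dvd (Dvd.intro _ rfl))) v)
      (shiftOp_div_mem (ihb (h.of_dvd (Dvd.intro_left _ rfl))) u)

/-- The first cell `[0, 1 / n)` is what remains of `[0, 1 / p)` when its translate by `1 / n` is
taken away. -/
theorem cellIndicator_zero_eq_mul {n p : ℕ} (hp : 2 ≤ p) (hpn : p ≤ n) :
    cellIndicator n 0 = arcIndicator 0 (1 / p) *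
      (1 - shiftFun (((-1 : ℤ) / n : ℝ) : UnitAddCircle) (arcIndicator 0 (1 / p))) := by
  have hp0 : (2 : ℝ) ≤ p := by exact_mod_cast hp
  have hpn' : (p : ℝ) ≤ n := by exact_mod_cast hpn
  have h1 : (1 : ℝ) / p ≤ 1 / 2 := one_div_le_one_div_of_le two_pos hp0
  have h2 : (1 : ℝ) / n ≤ 1 / p := one_div_le_one_div_of_le (by linarith) hpn'
  have h3 : (0 : ℝ) < 1 / n := one_div_pos.2 (by linarith)
  rw [shiftFun_arcIndicator]
  refine Subtype.ext (funext fun x => ?_)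
  obtain ⟨t, ⟨ht0, ht1⟩, rfl⟩ := AddCircle.eq_coe_Ico x
  -- Arcs inside `[0, 1)` need no integer translates.
  have hz : ∀ {p q : ℝ}, 0 ≤ p → q ≤ 1 →
      ((t : UnitAddCircle) ∈ arc p q ↔ p ≤ t ∧ t < q) := by
    intro p q hp hq
    rw [coe_mem_arc_iff]
    constructor
    · rintro ⟨z, hz1, hz2⟩
      have h1 : (-1 : ℝ) < z := by linarith
      have h2 : (z : ℝ) < 1 := by linarith
      have h1' : (-1 : ℤ) < z := by exact_mod_cast h1
      have h2' : z < (1 : ℤ) := by exact_mod_cast h2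
      obtain rfl : z = 0 := by omega
      simp only [Int.cast_zero, add_zero] at hz1 hz2
      exact ⟨hz1, hz2⟩
    · intro h
      exact ⟨0, by simpa using h⟩
  have e1 : ((0 : ℤ) : ℝ) / n = 0 := by simp
  have e2 : ((0 + 1 : ℤ) : ℝ) / n = 1 / n := by simp
  have e3 : (0 : ℝ) - (-1 : ℤ) / n = 1 / n := by push_cast; ring
  have e4 : (1 / p : ℝ) - (-1 : ℤ) / n = 1 / p + 1 / n := by push_cast; ring
  change (arc (((0 : ℤ) : ℝ) / n) (((0 + 1 : ℤ) : ℝ) / n)).indicator (1 : UnitAddCircle → ℂ) t =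
    (arc 0 (1 / p)).indicator (1 : UnitAddCircle → ℂ) t *
      (1 - (arc (0 - (-1 : ℤ) / n) (1 / p - (-1 : ℤ) / n)).indicator (1 : UnitAddCircle → ℂ) t)
  classical
  rw [e1, e2, e3, e4, Set.indicator_apply, Set.indicator_apply, Set.indicator_apply,
    hz le_rfl (by linarith), hz le_rfl (by linarith), hz h3.le (by linarith)]
  simp only [Pi.one_apply]
  by_cases ha : t < 1 / n
  · rw [if_pos ⟨ht0, ha⟩, if_pos ⟨ht0, by linarith⟩, if_neg fun h => by linarith [h.1]]
    ring
  · rw [if_neg fun h => ha h.2]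
    by_cases hb : t < 1 / p
    · rw [if_pos ⟨ht0, hb⟩, if_pos ⟨by linarith, by linarith⟩]
      ring
    · rw [if_neg fun h => hb h.2]
      ring

theorem gridAlgebra_le_fdAlgebra {𝔑 : SupernaturalNumber} {B : Set UnitAddCircle}
    (hB : primePowerPoints 𝔑 ⊆ B) {n : ℕ} (h : SupernaturalNumber.IsDivisor n 𝔑) :
    gridAlgebra h.1 ≤ fdAlgebra (primePowers 𝔑) B := by
  have hs := shiftOp_inv_mem_of_isDivisor (B := B) n h
  refine gridAlgebra_le h.1 hs ?_
  rcases eq_or_ne n 1 with rfl | hn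
  · have : cellIndicator 1 0 = 1 := by
      simpa using sum_cellIndicator one_pos
    rw [this, map_one]
    exact one_mem _
  · obtain ⟨p, hp, hpn⟩ := Nat.exists_prime_and_dvd hn
    rw [cellIndicator_zero_eq_mul hp.two_le (Nat.le_of_dvd h.1 hpn), map_mul, map_sub, map_one]
    have hpp : p ∈ primePowers 𝔑 := by
      have := SupernaturalNumber.prime_pow_mem_primePowers (j := 1) hp le_rfl
        (by rw [pow_one]; exact h.of_dvd hpn)
      rwa [pow_one] at this
    have harc : multHom (arcIndicator 0 (1 / p)) ∈ fdAlgebra (primePowers 𝔑) B :=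
      multHom_mem_fdAlgebra (isRegulated_of_mem_stepFunctions (Submodule.subset_span
        ⟨0, 1 / p, hB (Or.inl (AddCircle.coe_zero 1)), hB (Or.inr ⟨p, hpp, rfl⟩), rfl⟩))
    exact mul_mem harc (sub_mem (one_mem _) (multHom_shiftFun_mem (shiftOp_div_mem hs (-1)) harc))

/-- A step function with rational breakpoints acts by an element of the algebra of the grid
given by a common denominator. -/
theorem exists_multHom_mem_gridAlgebra {𝔑 : SupernaturalNumber} {s : UnitAddCircle → ℂ}
    (hs : s ∈ stepFunctions (rationalPoints 𝔑)) :
    ∃ (hs' : s ∈ essBoundedFunctions) (n : ℕ) (h : SupernaturalNumber.IsDivisor n 𝔑),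
      multHom ⟨s, hs'⟩ ∈ gridAlgebra h.1 := by
  -- A point of `𝕋` in `rationalPoints 𝔑` has only rational representatives, with an admissible
  -- denominator.
  have key : ∀ p : ℝ, ((p : UnitAddCircle) ∈ rationalPoints 𝔑) →
      ∃ n, SupernaturalNumber.IsDivisor n 𝔑 ∧ ∀ m : ℕ, 0 < m → n ∣ m → ∃ a : ℤ, p = a / m := by
    rintro p ⟨a, n, hn, h⟩
    obtain ⟨z, rfl⟩ := UnitAddCircle.coe_eq_coe_iff.1 h
    refine ⟨n, hn, ?_⟩
    rintro m hm ⟨r, rfl⟩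
    refine ⟨(a + z * n) * r, ?_⟩
    have hn0 : (n : ℝ) ≠ 0 := by exact_mod_cast hn.1.ne'
    have hr0 : (r : ℝ) ≠ 0 := by
      rintro h
      simp [Nat.cast_eq_zero.1 h] at hm
    push_cast
    field_simp
  induction hs using Submodule.span_induction with
  | mem f hf =>
    obtain ⟨p, q, hp, hq, rfl⟩ := hf
    obtain ⟨m, hm, hm'⟩ := key p hp
    obtain ⟨n, hn, hn'⟩ := key q hq
    have hmn := hm.lcm hn
    obtain ⟨a, rfl⟩ := hm' _ hmn.1 (Nat.dvd_lcm_left m n)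
    obtain ⟨b, rfl⟩ := hn' _ hmn.1 (Nat.dvd_lcm_right m n)
    exact ⟨(arcIndicator _ _).2, _, hmn, multHom_arcIndicator_mem_gridAlgebra hmn.1 a b⟩
  | zero =>
    refine ⟨zero_mem _, 1, SupernaturalNumber.isDivisor_one, ?_⟩
    exact (map_zero multHom).symm ▸ zero_mem _
  | add f g _ _ hf hg =>
    obtain ⟨hf', m, hm, hfm⟩ := hf
    obtain ⟨hg', n, hn, hgn⟩ := hg
    have hmn := hm.lcm hn
    refine ⟨add_mem hf' hg', _, hmn, ?_⟩
    have := add_mem (gridAlgebra_mono hm.1 hmn.1 (Nat.dvd_lcm_left m n) hfm)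
      (gridAlgebra_mono hn.1 hmn.1 (Nat.dvd_lcm_right m n) hgn)
    rwa [← map_add] at this
  | smul c f _ hf =>
    obtain ⟨hf', m, hm, hfm⟩ := hf
    refine ⟨essBoundedFunctions.toSubalgebra.smul_mem hf' c, m, hm, ?_⟩
    have := (gridAlgebra hm.1).toSubalgebra.smul_mem hfm c
    rwa [← map_smul] at this

theorem multHom_mem_closure_gridTower {𝔑 : SupernaturalNumber} {S : essBoundedFunctions}
    (hS : IsRegulated (rationalPoints 𝔑) S.1) :
    multHom S ∈ closure (⋃ m, (gridTower 𝔑 m : Set (L2Circle →L[ℂ] L2Circle))) := by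
  rw [Metric.mem_closure_iff]
  intro ε hε
  obtain ⟨s, hs, h⟩ := hS (ε / 2) (half_pos hε)
  obtain ⟨hs', n, hn, hmem⟩ := exists_multHom_mem_gridAlgebra hs
  refine ⟨_, Set.mem_iUnion.2 ⟨n, gridAlgebra_le_gridTower hn hmem⟩, ?_⟩
  rw [dist_eq_norm, ← map_sub]
  exact (norm_multHom_le _ (half_pos hε).le h).trans_lt (half_lt_self hε)

/-- For breakpoints between the two extreme choices, the algebra of finite differential operators is
the closed union of the tower of grid algebras. -/
theorem coe_fdAlgebra_eq_closure {𝔑 : SupernaturalNumber} {B : Set UnitAddCircle}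
    (hB : primePowerPoints 𝔑 ⊆ B) (hB' : B ⊆ rationalPoints 𝔑) :
    (fdAlgebra (primePowers 𝔑) B : Set (L2Circle →L[ℂ] L2Circle)) =
      closure (⋃ m, (gridTower 𝔑 m : Set (L2Circle →L[ℂ] L2Circle))) := by
  have hclosed : IsClosed (fdAlgebra (primePowers 𝔑) B : Set (L2Circle →L[ℂ] L2Circle)) :=
    isClosed_closure
  refine Set.Subset.antisymm ?_ (closure_minimal (Set.iUnion_subset fun m =>
    gridAlgebra_le_fdAlgebra hB (𝔑.isDivisor_divisorSeq m)) hclosed)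
  let U := (⨆ m, gridTower 𝔑 m).topologicalClosure
  have hU : (U : Set (L2Circle →L[ℂ] L2Circle)) =
      closure (⋃ m, (gridTower 𝔑 m : Set (L2Circle →L[ℂ] L2Circle))) := by
    rw [StarSubalgebra.topologicalClosure_coe,
      StarSubalgebra.coe_iSup_of_directed (isUHFTower_gridTower 𝔑).mono.directed_le]
  have hshift : ∀ q ∈ primePowers 𝔑, shiftOp ((1 / q : ℝ) : UnitAddCircle) ∈ U := by
    intro q hq
    have hd := SupernaturalNumber.isDivisor_of_mem_primePowers hq
    refine StarSubalgebra.le_topologicalClosure _ (le_iSup (gridTower 𝔑) q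
      (gridAlgebra_le_gridTower hd ?_))
    simpa using shiftOp_mem_gridAlgebra hd.1 1
  have hgen : fdGenerators (primePowers 𝔑) B ⊆ (U.toSubalgebra : Set _) := by
    rintro T (⟨q, hq, rfl⟩ | ⟨S, hS, rfl⟩)
    · exact U.toSubalgebra.smul_mem (sub_mem (hshift q hq) (one_mem U)) _
    · have hS' : IsRegulated (rationalPoints 𝔑) S := by
        intro ε hε
        obtain ⟨s, hs, h⟩ := hS ε hε
        refine ⟨s, Submodule.span_mono ?_ hs, h⟩
        rintro f ⟨p, q, hp, hq, rfl⟩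
        exact ⟨p, q, hB' hp, hB' hq, rfl⟩
      have := multHom_mem_closure_gridTower (S := ⟨S, hS.memLp⟩) hS'
      rw [← hU] at this
      exact this
  refine closure_minimal (fun T hT => ?_) isClosed_closure
  exact hU ▸ Algebra.adjoin_le hgen hT

theorem primePowerPoints_subset_rationalPoints (𝔑 : SupernaturalNumber) :
    primePowerPoints 𝔑 ⊆ rationalPoints 𝔑 := by
  rintro x (rfl | ⟨q, hq, rfl⟩)
  · exact ⟨0, 1, SupernaturalNumber.isDivisor_one, by simp⟩
  · exact ⟨1, q, SupernaturalNumber.isDivisor_of_mem_primePowers hq, by simp⟩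

/-- A UHF algebra is isomorphic to the algebra of finite differential operators with any set of
breakpoints between the two extreme choices. -/
theorem IsUHFTower.nonempty_equiv_fdAlgebra {V : Type*} [CStarAlgebra V] {𝔑 : SupernaturalNumber}
    {A : ℕ → StarSubalgebra ℂ V} {k : ℕ → ℕ} (hA : IsUHFTower 𝔑 A k)
    (hd : Dense (⋃ n, (A n : Set V))) {B : Set UnitAddCircle}
    (hB : primePowerPoints 𝔑 ⊆ B) (hB' : B ⊆ rationalPoints 𝔑) :
    Nonempty (V ≃⋆ₐ[ℂ] fdAlgebra (primePowers 𝔑) B) := by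
  have htop : ((⊤ : StarSubalgebra ℂ V) : Set V) = closure (⋃ n, (A n : Set V)) := by
    rw [hd.closure_eq]
    rfl
  obtain ⟨e⟩ := hA.nonempty_starAlgEquiv (isUHFTower_gridTower 𝔑) htop
    (coe_fdAlgebra_eq_closure hB hB')
  exact ⟨(StarAlgEquiv.ofBijective (⊤ : StarSubalgebra ℂ V).subtype
    ⟨Subtype.val_injective, fun x => ⟨⟨x, StarSubalgebra.mem_top⟩, rfl⟩⟩).symm.trans e⟩

/-! ### The CAR algebra -/

section JordanWigner

variable {W : Type*} [Ring W] [StarRing W]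

/-- The `2 × 2` matrix units given by an element `b` with `b ^ 2 = 0` and `b b* + b* b = 1`. -/
def fermionUnit (b : W) (s t : Fin 2) : W :=
  ![![b * star b, b], ![star b, star b * b]] s t

theorem isMatrixUnits_fermionUnit {b : W} (h0 : b * b = 0)
    (h1 : b * star b + star b * b = 1) : IsMatrixUnits (fermionUnit b) := by
  have h0' : star b * star b = 0 := by rw [← star_mul, h0, star_zero]
  have h2 : b * (star b * b) = b := by
    have := congrArg (b * ·) h1
    simpa [mul_add, ← mul_assoc, h0] using this
  have h3 : star b * (b * star b) = star b := by
    have := congrArg (star b * ·) h1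
    simpa [mul_add, ← mul_assoc, h0'] using this
  have h4 : ∀ x, b * (b * x) = 0 := fun x => by rw [← mul_assoc, h0, zero_mul]
  have h5 : ∀ x, star b * (star b * x) = 0 := fun x => by rw [← mul_assoc, h0', zero_mul]
  constructor
  · simp [Fin.forall_fin_two, fermionUnit, mul_assoc, h2, h3]
  · simp [Fin.forall_fin_two, fermionUnit, mul_assoc, h0, h0', h4, h5]
  · simp [Fin.forall_fin_two, fermionUnit]
  · simpa [Fin.sum_univ_two, fermionUnit] using h1

/-- The canonical anticommutation relations, in the form in which they are used for rewriting. -/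
structure IsCAR (a : ℕ → W) : Prop where
  sq : ∀ i, a i * a i = 0
  anticomm : ∀ i j, a i * a j = -(a j * a i)
  anticomm_star : ∀ i j, i ≠ j → a i * star (a j) = -(star (a j) * a i)
  add_star : ∀ i, a i * star (a i) + star (a i) * a i = 1

/-- The self-adjoint unitary `1 - 2 a_i* a_i`, the parity of the `i`-th mode. -/
def modeParity (a : ℕ → W) (i : ℕ) : W := 1 - 2 * (star (a i) * a i)

/-- The parity `∏_{i < n} (1 - 2 a_i* a_i)` of the first `n` modes. -/
def parity (a : ℕ → W) : ℕ → W
  | 0 => 1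
  | n + 1 => parity a n * modeParity a n

namespace IsCAR

variable {a : ℕ → W}

theorem star_modeParity (a : ℕ → W) (i : ℕ) : star (modeParity a i) = modeParity a i := by
  simp [modeParity, two_mul]

theorem modeParity_commute (h : IsCAR a) {i j : ℕ} (hij : i ≠ j) :
    Commute (modeParity a i) (a j) := by
  have : Commute (star (a i) * a i) (a j) := by
    rw [commute_iff_eq, mul_assoc, h.anticomm i j, mul_neg, ← mul_assoc, ← mul_assoc,
      h.anticomm_star j i hij.symm, neg_mul]
  exact (Commute.one_left _).sub_left ((Commute.ofNat_left 2 _).mul_left this)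

theorem mul_star_mul (h : IsCAR a) (i : ℕ) : a i * (star (a i) * a i) = a i := by
  have := congrArg (a i * ·) (h.add_star i)
  simpa [mul_add, ← mul_assoc, h.sq] using this

theorem modeParity_mul (h : IsCAR a) (i : ℕ) : modeParity a i * a i = -(a i * modeParity a i) := by
  have h1 : modeParity a i * a i = a i := by
    rw [modeParity, sub_mul, mul_assoc, mul_assoc, h.sq]
    simp
  have h2 : a i * modeParity a i = -a i := by
    rw [modeParity, mul_sub, two_mul, mul_add, h.mul_star_mul]
    simp
  rw [h1, h2, neg_neg]

theorem modeParity_sq (h : IsCAR a) (i : ℕ) : modeParity a i * modeParity a i = 1 := by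
  have h1 : star (a i) * a i * (star (a i) * a i) = star (a i) * a i := by
    rw [mul_assoc, h.mul_star_mul]
  rw [modeParity]
  generalize star (a i) * a i = x at h1
  have : (1 - 2 * x) * (1 - 2 * x) = 1 - 4 * x + 4 * (x * x) := by noncomm_ring
  rw [this, h1, sub_add_cancel]

theorem parity_commute (h : IsCAR a) (n : ℕ) : ∀ i, n ≤ i → Commute (parity a n) (a i) := by
  induction n with
  | zero => exact fun i _ => Commute.one_left _
  | succ n ih =>
    exact fun i hi => (ih i (by omega)).mul_left (h.modeParity_commute (by omega))

/-- The parity of the first `n` modes anticommutes with each of them. -/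
theorem parity_anticommute (h : IsCAR a) (n : ℕ) :
    ∀ i, i < n → parity a n * a i = -(a i * parity a n) := by
  induction n with
  | zero => exact fun i hi => absurd hi (Nat.not_lt_zero i)
  | succ n ih =>
    intro i hi
    rw [parity, mul_assoc]
    rcases Nat.lt_succ_iff_lt_or_eq.1 hi with hi | rfl
    · rw [(h.modeParity_commute hi.ne').eq, ← mul_assoc, ih i hi, neg_mul, mul_assoc]
    · rw [h.modeParity_mul, mul_neg, ← mul_assoc, (h.parity_commute i i le_rfl).eq, mul_assoc]

theorem parity_star_sq (h : IsCAR a) (n : ℕ) :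
    star (parity a n) = parity a n ∧ parity a n * parity a n = 1 := by
  induction n with
  | zero => simp [parity]
  | succ n ih =>
    have h1 := h.parity_commute n n le_rfl
    have h2 : Commute (parity a n) (star (a n)) := by
      have := h1.star_star
      rwa [ih.1] at this
    have h3 : Commute (parity a n) (modeParity a n) :=
      (Commute.one_right _).sub_right ((Commute.ofNat_right _ 2).mul_right (h2.mul_right h1))
    constructor
    · rw [parity, star_mul, ih.1, star_modeParity, h3.eq]
    · rw [parity, h3.symm.mul_mul_mul_comm, ih.2, h.modeParity_sq, one_mul]

/-- The Jordan–Wigner transform `parity a n * a n` of `a n` satisfies the same relations as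
`a n`. -/
theorem parity_mul_relations (h : IsCAR a) (n : ℕ) :
    (parity a n * a n) * (parity a n * a n) = 0 ∧
    (parity a n * a n) * star (parity a n * a n) + star (parity a n * a n) * (parity a n * a n)
      = 1 := by
  obtain ⟨hs, hq⟩ := h.parity_star_sq n
  have hc := (h.parity_commute n n le_rfl).eq
  constructor
  · rw [mul_assoc, ← mul_assoc (a n), ← hc, mul_assoc, h.sq, mul_zero, mul_zero]
  · have hc' : parity a n * star (a n) = star (a n) * parity a n := by
      have := congrArg star hc
      rwa [star_mul, star_mul, hs, eq_comm] at this
    rw [star_mul, hs, mul_assoc, ← hc', ← mul_assoc (a n), ← hc, mul_assoc,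
      ← mul_assoc (parity a n), hq, one_mul, hc', mul_assoc (star (a n)),
      ← mul_assoc (parity a n), hq, one_mul]
    exact h.add_star n

/-- The transform of `a n` commutes with the previous modes: the sign from the parity cancels that
from the anticommutation relations. -/
theorem commute_parity_mul (h : IsCAR a) {n i : ℕ} (hi : i < n) :
    Commute (parity a n * a n) (a i) ∧ Commute (parity a n * a n) (star (a i)) := by
  have h1 := h.parity_anticommute n i hi
  have h2 : parity a n * star (a i) = -(star (a i) * parity a n) := by
    have := congrArg star h1
    rw [star_mul, star_neg, star_mul, (h.parity_star_sq n).1] at this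
    rw [this, neg_neg]
  constructor
  · rw [commute_iff_eq, mul_assoc, h.anticomm n i, mul_neg, ← mul_assoc, h1, neg_mul, neg_neg,
      mul_assoc]
  · rw [commute_iff_eq, mul_assoc, h.anticomm_star n i hi.ne', mul_neg, ← mul_assoc, h2, neg_mul,
      neg_neg, mul_assoc]

variable [Algebra ℂ W] [StarModule ℂ W]

/-- The `*`-algebra generated by the first `n` modes. -/
def modeAlgebra (a : ℕ → W) (n : ℕ) : StarSubalgebra ℂ W :=
  StarAlgebra.adjoin ℂ (a '' Set.Iio n)

theorem mem_modeAlgebra {i n : ℕ} (h : i < n) : a i ∈ modeAlgebra a n :=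
  StarAlgebra.subset_adjoin ℂ _ ⟨i, h, rfl⟩

theorem modeAlgebra_mono (a : ℕ → W) : Monotone (modeAlgebra a) := fun _ _ h =>
  StarAlgebra.adjoin_mono (Set.image_mono (Set.Iio_subset_Iio h))

theorem parity_mem_modeAlgebra (a : ℕ → W) (n : ℕ) : parity a n ∈ modeAlgebra a n := by
  induction n with
  | zero => exact one_mem _
  | succ n ih =>
    have := mem_modeAlgebra (a := a) n.lt_succ_self
    exact mul_mem (modeAlgebra_mono a n.le_succ ih) (sub_mem (one_mem _)
      (mul_mem (ofNat_mem _ 2) (mul_mem (star_mem this) this)))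

theorem commute_of_mem_modeAlgebra (h : IsCAR a) {n : ℕ} {x : W} (hx : x ∈ modeAlgebra a n) :
    Commute (parity a n * a n) x ∧ Commute (star (parity a n * a n)) x := by
  induction hx using StarAlgebra.adjoin_induction with
  | mem x hx =>
    obtain ⟨i, hi, rfl⟩ := hx
    obtain ⟨h1, h2⟩ := h.commute_parity_mul hi
    exact ⟨h1, by simpa using h2.star_star⟩
  | algebraMap r => exact ⟨(Algebra.commutes r _).symm, (Algebra.commutes r _).symm⟩
  | add x y _ _ hx hy => exact ⟨hx.1.add_right hy.1, hx.2.add_right hy.2⟩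
  | mul x y _ _ hx hy => exact ⟨hx.1.mul_right hy.1, hx.2.mul_right hy.2⟩
  | star x _ hx => exact ⟨by simpa using hx.2.star_star, by simpa using hx.1.star_star⟩

/-- The first `n` modes generate a full matrix algebra of size `2 ^ n`: by the Jordan–Wigner
transform, each mode adds a tensor factor of `2 × 2` matrices. -/
theorem exists_isMatrixUnits (h : IsCAR a) (n : ℕ) :
    ∃ (e : Fin (2 ^ n) → Fin (2 ^ n) → W) (he : IsMatrixUnits e),
      he.lift.range = modeAlgebra a n := by
  induction n with
  | zero =>
    have he : IsMatrixUnits (fun _ _ => 1 : Fin (2 ^ 0) → Fin (2 ^ 0) → W) :=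
      ⟨by simp, fun i j k l h => absurd (Fin.subsingleton_one.elim j k) h, by simp, by simp⟩
    refine ⟨_, he, le_antisymm (he.range_lift_le fun _ _ => one_mem _) ?_⟩
    rw [modeAlgebra, StarAlgebra.adjoin_le_iff]
    rintro _ ⟨i, hi, -⟩
    exact absurd hi (Nat.not_lt_zero i)
  | succ n ih =>
    obtain ⟨e, he, hr⟩ := ih
    obtain ⟨hb0, hb1⟩ := h.parity_mul_relations n
    have hcomm := fun x hx => h.commute_of_mem_modeAlgebra (n := n) (x := x) hx
    have hbmem : parity a n * a n ∈ modeAlgebra a (n + 1) :=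
      mul_mem (modeAlgebra_mono a n.le_succ (parity_mem_modeAlgebra a n))
        (mem_modeAlgebra n.lt_succ_self)
    have han : parity a n * (parity a n * a n) = a n := by
      rw [← mul_assoc, (h.parity_star_sq n).2, one_mul]
    generalize parity a n * a n = b at *
    have hf := isMatrixUnits_fermionUnit hb0 hb1
    have hemem : ∀ i j, e i j ∈ modeAlgebra a n := fun i j =>
      hr ▸ ⟨Matrix.single i j 1, he.lift_single i j⟩
    have hc : ∀ i j s t, Commute (e i j) (fermionUnit b s t) := by
      intro i j
      obtain ⟨h1, h2⟩ := hcomm _ (hemem i j)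
      simp only [Fin.forall_fin_two, fermionUnit]
      exact ⟨⟨(h1.mul_left h2).symm, h1.symm⟩, ⟨h2.symm, (h2.mul_left h1).symm⟩⟩
    let σ : Fin (2 ^ (n + 1)) ≃ Fin (2 ^ n) × Fin 2 :=
      (finCongr (pow_succ 2 n)).trans finProdFinEquiv.symm
    have he' := (he.prod hf hc).reindex σ
    refine ⟨_, he', le_antisymm (he'.range_lift_le fun x y => ?_) ?_⟩
    · refine mul_mem (modeAlgebra_mono a n.le_succ (hemem _ _)) ?_
      have : ∀ s t, fermionUnit b s t ∈ modeAlgebra a (n + 1) := by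
        simp only [Fin.forall_fin_two, fermionUnit]
        exact ⟨⟨mul_mem hbmem (star_mem hbmem), hbmem⟩,
          ⟨star_mem hbmem, mul_mem (star_mem hbmem) hbmem⟩⟩
      exact this _ _
    · have hmem : ∀ i j s t, e i j * fermionUnit b s t ∈ he'.lift.range := fun i j s t =>
        ⟨Matrix.single (σ.symm (i, s)) (σ.symm (j, t)) 1, by
          change he'.lift _ = _
          rw [he'.lift_single]
          simp⟩
      have hle : modeAlgebra a n ≤ he'.lift.range := by
        rw [← hr]
        refine he.range_lift_le fun i j => ?_
        rw [← mul_one (e i j), ← hf.sum_eq, Finset.mul_sum]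
        exact sum_mem fun s _ => hmem i j s s
      have hb : b ∈ he'.lift.range := by
        have : ∑ i, e i i * fermionUnit b 0 1 = b := by
          rw [← Finset.sum_mul, he.sum_eq, one_mul]
          rfl
        have hsum : ∑ i, e i i * fermionUnit b 0 1 ∈ he'.lift.range :=
          sum_mem fun i _ => hmem i i 0 1
        rwa [this] at hsum
      rw [modeAlgebra, StarAlgebra.adjoin_le_iff]
      rintro _ ⟨i, hi, rfl⟩
      rcases Nat.lt_succ_iff_lt_or_eq.1 hi with hi | rfl
      · exact hle (mem_modeAlgebra hi)
      · exact han ▸ mul_mem (hle (parity_mem_modeAlgebra a i)) hb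

end IsCAR

end JordanWigner

/-- The supernatural number `2 ^ ∞`. -/
def twoPowTop : SupernaturalNumber := fun p => if (p : ℕ) = 2 then ⊤ else 0

theorem IsCARAlgebra.isCAR {W : Type*} [CStarAlgebra W] {a : ℕ → W} (h : IsCARAlgebra a) :
    IsCAR a where
  sq i := by
    have h1 : (2 : ℂ) • (a i * a i) = 0 := by rw [two_smul, h.anticomm]
    exact (smul_eq_zero.1 h1).resolve_left two_ne_zero
  anticomm i j := eq_neg_of_add_eq_zero_left (h.anticomm i j)
  anticomm_star i j hij := eq_neg_of_add_eq_zero_left ((h.anticomm_star i j).trans (if_neg hij))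
  add_star i := (h.anticomm_star i i).trans (if_pos rfl)

theorem IsCARAlgebra.isUHFTower {W : Type*} [CStarAlgebra W] {a : ℕ → W} (h : IsCARAlgebra a) :
    IsUHFTower twoPowTop (IsCAR.modeAlgebra a) (fun n => 2 ^ n) where
  mono := IsCAR.modeAlgebra_mono a
  pos n := pow_pos two_pos n
  iso n := by
    have := h.nontrivial
    obtain ⟨e, he, hr⟩ := h.isCAR.exists_isMatrixUnits n
    have : Nonempty (Fin (2 ^ n)) := ⟨⟨0, pow_pos two_pos n⟩⟩
    rw [← hr]
    exact ⟨(StarAlgEquiv.ofInjective _ he.lift.injective_of_matrix).symm⟩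
  exponent p := by
    simp only [twoPowTop, Nat.prime_two.factorization_pow, Finsupp.single_apply, eq_comm (a := 2)]
    split_ifs
    · refine (ENat.eq_top_iff_forall_ge.2 fun m => ?_).symm
      exact le_iSup (fun n : ℕ => (n : ℕ∞)) m
    · simp

theorem IsCARAlgebra.dense_iUnion_modeAlgebra {W : Type*} [CStarAlgebra W] {a : ℕ → W}
    (h : IsCARAlgebra a) : Dense (⋃ n, (IsCAR.modeAlgebra a n : Set W)) := by
  rw [← StarSubalgebra.coe_iSup_of_directed (IsCAR.modeAlgebra_mono a).directed_le]
  have hle : StarAlgebra.adjoin ℂ (Set.range a) ≤ ⨆ n, IsCAR.modeAlgebra a n := by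
    rw [StarAlgebra.adjoin_le_iff]
    rintro _ ⟨i, rfl⟩
    exact le_iSup (IsCAR.modeAlgebra a) (i + 1) (IsCAR.mem_modeAlgebra i.lt_succ_self)
  have hd : Dense (StarAlgebra.adjoin ℂ (Set.range a) : Set W) := by
    rw [dense_iff_closure_eq, ← StarSubalgebra.topologicalClosure_coe, h.generates]
    rfl
  exact hd.mono hle

theorem mem_primePowers_twoPowTop {q : ℕ} :
    q ∈ primePowers twoPowTop ↔ ∃ j : ℕ, 1 ≤ j ∧ q = 2 ^ j := by
  constructor
  · rintro ⟨p, j, hj, hp, rfl⟩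
    by_cases h2 : (p : ℕ) = 2
    · exact ⟨j, hj, by rw [h2]⟩
    · rw [twoPowTop, if_neg h2] at hp
      have : j ≤ 0 := by exact_mod_cast hp
      omega
  · rintro ⟨j, hj, rfl⟩
    exact ⟨⟨2, Nat.prime_two⟩, j, hj, by simp [twoPowTop], rfl⟩

theorem isDivisor_twoPowTop_iff {n : ℕ} :
    SupernaturalNumber.IsDivisor n twoPowTop ↔ ∃ j : ℕ, n = 2 ^ j := by
  constructor
  · intro h
    refine ⟨n.factorization 2, ?_⟩
    refine Nat.eq_pow_of_factorization_eq_single h.1.ne' (Finsupp.ext fun p => ?_)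
    rw [Finsupp.single_apply]
    split_ifs with hp
    · rw [hp]
    · by_cases hpp : p.Prime
      · have : (n.factorization p : ℕ∞) ≤ if p = 2 then ⊤ else 0 := h.2 ⟨p, hpp⟩
        rw [if_neg (fun h => hp h.symm)] at this
        exact Nat.le_zero.1 (by exact_mod_cast this)
      · exact Nat.factorization_eq_zero_of_not_prime n hpp
  · rintro ⟨j, rfl⟩
    refine SupernaturalNumber.isDivisor_prime_pow (p := ⟨2, Nat.prime_two⟩).2 ?_
    simp [twoPowTop]

theorem dyadicFDAlgebra_eq :
    dyadicFDAlgebra = fdAlgebra (primePowers twoPowTop) (rationalPoints twoPowTop) := by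
  have h1 : {q | ∃ j : ℕ, 1 ≤ j ∧ q = 2 ^ j} = primePowers twoPowTop :=
    Set.ext fun q => mem_primePowers_twoPowTop.symm
  have h2 : {x | ∃ (m : ℤ) (j : ℕ), x = ((m / 2 ^ j : ℝ) : UnitAddCircle)} =
      rationalPoints twoPowTop := by
    ext x
    constructor
    · rintro ⟨m, j, rfl⟩
      exact ⟨m, 2 ^ j, isDivisor_twoPowTop_iff.2 ⟨j, rfl⟩, by push_cast; rfl⟩
    · rintro ⟨m, n, hn, rfl⟩
      obtain ⟨j, rfl⟩ := isDivisor_twoPowTop_iff.1 hn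
      exact ⟨m, j, by push_cast; rfl⟩
  rw [dyadicFDAlgebra, h1, h2]

theorem mainTheorem2 :
    (∀ (V : Type*) [CStarAlgebra V] (𝔑 : SupernaturalNumber), IsUHF V 𝔑 →
      Nonempty (V ≃⋆ₐ[ℂ] scalarFDAlgebra 𝔑) ∧
      Nonempty (V ≃⋆ₐ[ℂ] fdAlgebra (primePowers 𝔑) (rationalPoints 𝔑))) ∧
    (∀ (W : Type*) [CStarAlgebra W] (a : ℕ → W), IsCARAlgebra a →
      Nonempty (W ≃⋆ₐ[ℂ] dyadicFDAlgebra)) := by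
  refine ⟨fun V _ 𝔑 ⟨A, k, hmono, hiso, hd, hk⟩ => ?_, fun W _ a ha => ?_⟩
  · have hA : IsUHFTower 𝔑 A k := ⟨hmono, fun n => (hiso n).1, fun n => (hiso n).2, hk⟩
    have hsub := primePowerPoints_subset_rationalPoints 𝔑
    exact ⟨hA.nonempty_equiv_fdAlgebra hd subset_rfl hsub,
      hA.nonempty_equiv_fdAlgebra hd hsub subset_rfl⟩
  · rw [dyadicFDAlgebra_eq]
    exact ha.isUHFTower.nonempty_equiv_fdAlgebra ha.dense_iUnion_modeAlgebra
      (primePowerPoints_subset_rationalPoints _) subset_rfl
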